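/- Let $\Sigma=\{1,\dots,\sigma\}$ be an alphabet with $\sigma$ letters. A word $w\in\Sigma^*$ is $k$-universal if every word of length $k$ over $\Sigma$ is a (scattered) subsequence of $w$. The problem $k$-ESU for regular expressions asks, given $\sigma$, a regular expression $R$ over $\Sigma$ and an integer $k\ge 0$, whether the language $L(R)$ contains a $k$-universal word. Regular expressions are given as strings over the symbols $\emptyset,\varepsilon,(,),|,*$ and the letters of $\Sigma$, built from $\emptyset$, $\varepsilon$ and the letters by forming $R_1R_2$, $(R_1|R_2)$ and $(R_1)^*$; the length $n$ of $R$ is the number of symbols of this string. **Theorem.** For a regular expression $R$ of length $n$ over an alphabet of size $\sigma$, $k$-ESU can be decided in $O(n\cdot 2^\sigma)$ time on the unit-cost word RAM. Precisely: there are a single word RAM program $P$ and a constant $c$ such that for all $\sigma\ge 0$, all $R$ over $\Sigma$ of length $n$, all $k\ge 0$ and all word sizes $\omega$ with $c\,n\,2^\sigma\le 2^\omega$ and $k<2^\omega$ (so that the memory used can be addressed and $k$ fits into one word), the program $P$, started on $(\sigma,k,n)$ in registers and $R$ with one symbol per memory cell, halts after at most $c\,n\,2^\sigma$ steps and answers correctly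 whether $L(R)$ contains a $k$-universal word. -/

import Mathlib

/-! ### Subsequence universality -/

/-- A word `v` over the alphabet `α` is `k`-subsequence universal if every word of length `k`
over `α` is a (scattered) subsequence of `v`. -/
def IsKUniversal {α : Type*} (k : ℕ) (v : List α) : Prop :=
  ∀ u : List α, u.length = k → u.Sublist v

/-- A language is existence `k`-subsequence universal if it contains a `k`-universal word. -/
def ExistsKUniversal {α : Type*} (k : ℕ) (L : Language α) : Prop :=
  ∃ v ∈ L, IsKUniversal k v

/-! ### Regular expressions as strings -/

/-- The symbols with which regular expressions over the alphabet `α` are written: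
`∅`, `ε`, the opening and the closing parenthesis, `|`, `*`, and the letters. -/
inductive RegexSymbol (α : Type*) where
  | empty : RegexSymbol α
  | eps : RegexSymbol α
  | lpar : RegexSymbol α
  | rpar : RegexSymbol α
  | bar : RegexSymbol α
  | star : RegexSymbol α
  | letter : α → RegexSymbol α

/-- The string that denotes a regular expression:
`∅`, `ε`, `a`, `(R₁|R₂)`, `R₁R₂` and `(R₁)*`. -/
def regexString {α : Type*} : RegularExpression α → List (RegexSymbol α)
  | .zero => [.empty]
  | .epsilon => [.eps]
  | .char a => [.letter a]
  | .plus R₁ R₂ => [.lpar] ++ regexString R₁ ++ [.bar] ++ regexString R₂ ++ [.rpar]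
  | .comp R₁ R₂ => regexString R₁ ++ regexString R₂
  | .star R₁ => [.lpar] ++ regexString R₁ ++ [.rpar, .star]

/-- The length of a regular expression is the number of symbols of its string. -/
def regexLength {α : Type*} (R : RegularExpression α) : ℕ :=
  (regexString R).length

/-! ### The unit-cost word RAM -/

namespace WordRAM

/-- The binary operations on words. -/
inductive BinOp where
  | add | sub | mul | div | mod | and | or | xor | shl | shr

/-- Results of operations on words of `w` bits are taken modulo `2 ^ w`. -/
def BinOp.eval (w : ℕ) : BinOp → ℕ → ℕ → ℕ
  | .add, x, y => (x + y) % 2 ^ w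
  | .sub, x, y => (x + 2 ^ w - y) % 2 ^ w
  | .mul, x, y => (x * y) % 2 ^ w
  | .div, x, y => (x / y) % 2 ^ w
  | .mod, x, y => (x % y) % 2 ^ w
  | .and, x, y => (x &&& y) % 2 ^ w
  | .or, x, y => (x ||| y) % 2 ^ w
  | .xor, x, y => (x ^^^ y) % 2 ^ w
  | .shl, x, y => (x <<< y) % 2 ^ w
  | .shr, x, y => (x >>> y) % 2 ^ w

/-- The instructions. A program names finitely many registers; the memory is reached by
indirect addressing only. -/
inductive Instr where
  /-- `reg d := c` -/
  | const (d c : ℕ)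
  /-- `reg d := reg a ∘ reg b` -/
  | op (o : BinOp) (d a b : ℕ)
  /-- `reg d := mem (reg a)` -/
  | load (d a : ℕ)
  /-- `mem (reg a) := reg b` -/
  | store (a b : ℕ)
  /-- if `reg a = reg b`, continue with instruction number `l` -/
  | jumpEq (a b l : ℕ)
  /-- if `reg a < reg b`, continue with instruction number `l` -/
  | jumpLt (a b l : ℕ)
  | halt

/-- A configuration: program counter, registers and memory. -/
structure State where
  pc : ℕ
  reg : ℕ → ℕ
  mem : ℕ → ℕ

/-- The effect of one instruction, on a machine with words of `w` bits. -/
def Instr.exec (w : ℕ) (s : State) : Instr → State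
  | .const d c => ⟨s.pc + 1, Function.update s.reg d (c % 2 ^ w), s.mem⟩
  | .op o d a b => ⟨s.pc + 1, Function.update s.reg d (o.eval w (s.reg a) (s.reg b)), s.mem⟩
  | .load d a => ⟨s.pc + 1, Function.update s.reg d (s.mem (s.reg a)), s.mem⟩
  | .store a b => ⟨s.pc + 1, s.reg, Function.update s.mem (s.reg a) (s.reg b)⟩
  | .jumpEq a b l => ⟨if s.reg a = s.reg b then l else s.pc + 1, s.reg, s.mem⟩
  | .jumpLt a b l => ⟨if s.reg a < s.reg b then l else s.pc + 1, s.reg, s.mem⟩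
  | .halt => s

/-- The machine has halted if it is at a `halt` instruction or has left the program. -/
def Halted (P : List Instr) (s : State) : Prop :=
  P[s.pc]? = none ∨ P[s.pc]? = some Instr.halt

/-- One step of the program `P`; every instruction takes one unit of time. -/
def step (w : ℕ) (P : List Instr) (s : State) : State :=
  match P[s.pc]? with
  | some i => i.exec w s
  | none => s

/-- Started in `s` with words of `w` bits, the program `P` halts after at most `t` steps, and
then register `0` holds `1` if `A` is true and `0` if `A` is false. -/
def DecidesWithin (w : ℕ) (P : List Instr) (s : State) (t : ℕ) (A : Prop) : Prop :=
  ∃ t' ≤ t, Halted P ((step w P)^[t'] s) ∧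
    ((A ∧ ((step w P)^[t'] s).reg 0 = 1) ∨ (¬ A ∧ ((step w P)^[t'] s).reg 0 = 0))

end WordRAM

/-! ### Inputs -/

/-- The code of a symbol; the letters `0, …, σ - 1` are coded by `6, …, σ + 5`. -/
def RegexSymbol.code {σ : ℕ} : RegexSymbol (Fin σ) → ℕ
  | .empty => 0
  | .eps => 1
  | .lpar => 2
  | .rpar => 3
  | .bar => 4
  | .star => 5
  | .letter a => 6 + a

/-- The initial configuration for the regular expression `R` over the alphabet `Fin σ` and the
number `k`: registers `0`, `1`, `2` hold `σ`, `k` and the length of `R`, the symbols of `R` are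
in the first memory cells, one per cell, and everything else is `0`. -/
def esuInput {σ : ℕ} (R : RegularExpression (Fin σ)) (k : ℕ) : WordRAM.State where
  pc := 0
  reg := fun i => [σ, k, regexLength R].getD i 0
  mem := fun i => ((regexString R).map RegexSymbol.code).getD i 0

/-! Cut a word greedily into arches, shortest blocks that contain every letter. The word is
`k`-universal exactly if at least `k` arches are completed (`isKUniversal_iff_le_archRun`). While a
word is read, only the number of completed arches and the set of letters of the current arch matter.
More arches always beat a larger set, and for equal counts a superset is better. This order is
preserved by reading (`archRun_mono`), so for each of the `2 ^ σ` sets it suffices to remember the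
best count, capped at `k`. An expression thus acts on tables of size `2 ^ σ` (`Transfers`):
concatenation is composition, alternation starts both parts from the same table and takes the
entrywise maximum, and a letter moves each set `S` to `S ∪ {a}` and closes the arch if that set is
full.

The decisive case is the star, which needs no iteration, since its effect depends only on the set
`A` of letters occurring in the language. If `A` is not full, a word of the star completes at most
one arch, because afterwards the current set stays inside `A`. The best outcome is therefore `(c, S
∪ A)`, or one arch more with remainder `A` if `S ∪ A` is full (`Transfers.star_of_ne_full`). If `A`
is full, arbitrarily many arches can be completed (`Transfers.star_of_full`). The letter sets are
computed alongside, with an extra bit for nonemptiness (`LetterMask`), because concatenation with an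
empty language must forget all letters.

Finally `k` may be replaced by `min k (2 * n)` (`existsKUniversal_min_iff`), so the counts fit into
words whatever `k` is. The expression is then evaluated in one pass with a stack of tables and a
bounded number of table passes per symbol (`mainLoop_spec`). The program is written in a small
structured language, verified by weakest preconditions that also count steps, and compiled with
exact preservation of time (`Exec.compile`). -/

namespace KUniversality

section

open scoped Computability

/-! ### Arch counting with a cap -/

/-- Increase an arch counter, unless it has reached the cap `k`. -/
def bump (k c : ℕ) : ℕ := if c < k then c + 1 else c

/-- Reading the letter `a` in the state `x`, which consists of the number of completed arches and
the set (as a bit mask) of the letters of the current arch. -/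
def archStep (τ k a : ℕ) (x : ℕ × ℕ) : ℕ × ℕ :=
  if x.2 ||| 2 ^ a = 2 ^ τ - 1 then (bump k x.1, 0) else (x.1, x.2 ||| 2 ^ a)

/-- Reading a word. -/
def archRun {σ : ℕ} (τ k : ℕ) (x : ℕ × ℕ) (v : List (Fin σ)) : ℕ × ℕ :=
  v.foldl (fun y a => archStep τ k a y) x

/-- The state `y` is at least as good as `x`. -/
def Dominated (k : ℕ) (x y : ℕ × ℕ) : Prop :=
  k ≤ y.1 ∨ x.1 < y.1 ∨ (x.1 = y.1 ∧ x.2 ||| y.2 = y.2)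

/-- The set of letters of a word, as a bit mask. -/
def wordMask {σ : ℕ} (v : List (Fin σ)) : ℕ := v.foldr (fun a m => 2 ^ a.val ||| m) 0

variable {σ τ k : ℕ}

@[simp] lemma archRun_nil (x : ℕ × ℕ) : archRun τ k x ([] : List (Fin σ)) = x := rfl

@[simp] lemma archRun_cons (x : ℕ × ℕ) (a : Fin σ) (v : List (Fin σ)) :
    archRun τ k x (a :: v) = archRun τ k (archStep τ k a x) v := rfl

lemma archRun_append (x : ℕ × ℕ) (u v : List (Fin σ)) :
    archRun τ k x (u ++ v) = archRun τ k (archRun τ k x u) v := by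
  simp [archRun, List.foldl_append]

@[simp] lemma wordMask_nil : wordMask ([] : List (Fin σ)) = 0 := rfl

@[simp] lemma wordMask_cons (a : Fin σ) (v : List (Fin σ)) :
    wordMask (a :: v) = 2 ^ a.val ||| wordMask v := rfl

lemma wordMask_append (u v : List (Fin σ)) :
    wordMask (u ++ v) = wordMask u ||| wordMask v := by
  induction u with
  | nil => simp
  | cons a u ih => simp [ih, Nat.or_assoc]

lemma testBit_wordMask (v : List (Fin σ)) (i : ℕ) :
    (wordMask v).testBit i = true ↔ ∃ a ∈ v, a.val = i := by
  induction v with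
  | nil => simp
  | cons a v ih => simp [Nat.testBit_or, Nat.testBit_two_pow, ih]

lemma or_eq_right_iff {S T : ℕ} :
    S ||| T = T ↔ ∀ i, S.testBit i = true → T.testBit i = true := by
  constructor
  · intro h i hi
    rw [← h, Nat.testBit_or, hi, Bool.true_or]
  · intro h
    apply Nat.eq_of_testBit_eq
    intro i
    rw [Nat.testBit_or]
    cases hS : S.testBit i
    · simp
    · simp [h i hS]

lemma full_or {S : ℕ} (h : S < 2 ^ τ) : (2 ^ τ - 1) ||| S = 2 ^ τ - 1 := by
  rw [Nat.or_comm, or_eq_right_iff]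
  intro i hi
  rw [Nat.testBit_two_pow_sub_one, decide_eq_true_eq]
  by_contra hn
  rw [Nat.testBit_lt_two_pow (lt_of_lt_of_le h (Nat.pow_le_pow_right (by simp) (by omega)))] at hi
  simp at hi

lemma eq_full_iff {S : ℕ} (h : S < 2 ^ τ) :
    S = 2 ^ τ - 1 ↔ ∀ i < τ, S.testBit i = true := by
  constructor
  · rintro rfl i hi
    simpa using hi
  · intro hS
    have := full_or h
    rw [Nat.or_comm] at this
    rw [← this, Nat.or_comm, eq_comm, or_eq_right_iff]
    intro i hi
    exact hS i (by simpa using hi)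

lemma or_two_pow_lt {S a : ℕ} (hS : S < 2 ^ τ) (ha : a < τ) : S ||| 2 ^ a < 2 ^ τ :=
  Nat.or_lt_two_pow hS (Nat.pow_lt_pow_right (by simp) ha)

lemma wordMask_lt (hστ : σ ≤ τ) (v : List (Fin σ)) : wordMask v < 2 ^ τ := by
  induction v with
  | nil => simp
  | cons a v ih =>
    exact Nat.or_lt_two_pow (Nat.pow_lt_pow_right (by simp) (by omega)) ih

lemma bump_ge (k c : ℕ) : c ≤ bump k c := by unfold bump; split <;> omega

lemma Dominated.refl (x : ℕ × ℕ) : Dominated k x x := by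
  simp [Dominated]

lemma Dominated.trans {x y z : ℕ × ℕ} (h₁ : Dominated k x y) (h₂ : Dominated k y z) :
    Dominated k x z := by
  unfold Dominated at *
  rcases h₁ with h₁ | h₁ | ⟨h₁, h₁'⟩ <;> rcases h₂ with h₂ | h₂ | ⟨h₂, h₂'⟩ <;> try omega
  right; right
  refine ⟨h₁.trans h₂, ?_⟩
  rw [← h₂', ← Nat.or_assoc, h₁']

lemma Dominated.of_le {c d S : ℕ} (h : c ≤ d) : Dominated k (c, S) (d, S) := by
  unfold Dominated
  simp only [Nat.or_self, and_true]
  omega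

lemma dominated_bump {c S T : ℕ} : Dominated k (c, S) (bump k c, T) := by
  unfold Dominated bump
  dsimp only
  split <;> omega

lemma archStep_snd_lt {a : ℕ} {x : ℕ × ℕ} (hτ : 0 < τ) (ha : a < τ) (hx : x.2 < 2 ^ τ - 1) :
    (archStep τ k a x).2 < 2 ^ τ - 1 := by
  have h1 : 1 < 2 ^ τ := Nat.one_lt_two_pow (by omega)
  have h2 := or_two_pow_lt (S := x.2) (τ := τ) (by omega) ha
  unfold archStep
  split
  · dsimp only; omega
  · dsimp only; omega

lemma archRun_snd_lt (hτ : 0 < τ) (hστ : σ ≤ τ) {x : ℕ × ℕ} (hx : x.2 < 2 ^ τ - 1)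
    (v : List (Fin σ)) : (archRun τ k x v).2 < 2 ^ τ - 1 := by
  induction v generalizing x with
  | nil => exact hx
  | cons a v ih => exact ih (archStep_snd_lt hτ (by omega) hx)

/-- A state that is behind in arches can at best catch up with one letter, and then its current set
is empty, which is below every set. For equal counts, if the smaller set becomes full, so does the
larger one. -/
lemma archStep_mono {a : ℕ} {x y : ℕ × ℕ} (ha : a < τ) (hy : y.2 < 2 ^ τ - 1)
    (h : Dominated k x y) : Dominated k (archStep τ k a x) (archStep τ k a y) := by
  have key : ∀ z : ℕ × ℕ, z.1 ≤ (archStep τ k a z).1 := by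
    intro z; unfold archStep; split
    · exact bump_ge _ _
    · exact le_rfl
  have hky := key y
  rcases h with h | h | ⟨h, h'⟩
  · exact Or.inl (h.trans hky)
  · by_cases hk : k ≤ y.1
    · exact Or.inl (hk.trans hky)
    unfold archStep
    split
    · have hb : bump k x.1 = x.1 + 1 := by unfold bump; rw [if_pos]; omega
      rw [hb]
      split
      · have : bump k y.1 = y.1 + 1 := by unfold bump; rw [if_pos]; omega
        right; left; dsimp only; omega
      · by_cases hxy : x.1 + 1 = y.1
        · right; right; exact ⟨hxy, by simp⟩
        · right; left; dsimp only; omega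
    · split
      · right; left; have := bump_ge k y.1; dsimp only; omega
      · right; left; exact h
  · unfold archStep
    rw [h]
    have hor : (x.2 ||| 2 ^ a) ||| (y.2 ||| 2 ^ a) = y.2 ||| 2 ^ a := by
      rw [or_eq_right_iff] at h' ⊢
      intro i hi
      rw [Nat.testBit_or, Bool.or_eq_true] at hi ⊢
      exact hi.imp (h' i) id
    split
    · rename_i hx
      have : y.2 ||| 2 ^ a = 2 ^ τ - 1 := by
        rw [← hor, hx, full_or (or_two_pow_lt (by omega) ha)]
      rw [if_pos this]
      exact Dominated.refl _
    · split
      · exact dominated_bump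
      · right; right; exact ⟨rfl, hor⟩

lemma archRun_mono (hτ : 0 < τ) (hστ : σ ≤ τ) {x y : ℕ × ℕ} (hy : y.2 < 2 ^ τ - 1)
    (h : Dominated k x y) (v : List (Fin σ)) :
    Dominated k (archRun τ k x v) (archRun τ k y v) := by
  induction v generalizing x y with
  | nil => exact h
  | cons a v ih =>
    exact ih (archStep_snd_lt hτ (by omega) hy) (archStep_mono (by omega) hy h)

lemma dominated_archStep (a : ℕ) (x : ℕ × ℕ) : Dominated k x (archStep τ k a x) := by
  unfold archStep
  split
  · exact dominated_bump
  · right; right; exact ⟨rfl, by rw [← Nat.or_assoc, Nat.or_self]⟩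

lemma dominated_archRun (x : ℕ × ℕ) (v : List (Fin σ)) : Dominated k x (archRun τ k x v) := by
  induction v generalizing x with
  | nil => exact Dominated.refl _
  | cons a v ih => exact (dominated_archStep a x).trans (ih _)

lemma le_archRun_fst {x : ℕ × ℕ} (h : k ≤ x.1) (v : List (Fin σ)) :
    k ≤ (archRun τ k x v).1 := by
  rcases dominated_archRun (k := k) (τ := τ) x v with h' | h' | h' <;> omega

/-- No arch is completed as long as a letter is missing. -/
lemma archRun_eq (hστ : σ ≤ τ) {c S : ℕ} (hS : S < 2 ^ τ) (v : List (Fin σ))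
    (h : S ||| wordMask v ≠ 2 ^ τ - 1) :
    archRun τ k (c, S) v = (c, S ||| wordMask v) := by
  induction v generalizing S with
  | nil => simp
  | cons a v ih =>
    rw [wordMask_cons, ← Nat.or_assoc] at h ⊢
    have ha : S ||| 2 ^ a.val ≠ 2 ^ τ - 1 := by
      intro ha
      rw [ha, full_or (wordMask_lt hστ v)] at h
      exact h rfl
    rw [archRun_cons, archStep, if_neg ha]
    exact ih (or_two_pow_lt hS (by omega)) h

/-- An arch is completed when all letters have been read. -/
lemma dominated_archRun_of_full (hστ : σ ≤ τ) {c S : ℕ} (hS : S < 2 ^ τ - 1)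
    (v : List (Fin σ)) (h : S ||| wordMask v = 2 ^ τ - 1) :
    Dominated k (bump k c, 0) (archRun τ k (c, S) v) := by
  induction v generalizing S with
  | nil => simp at h; omega
  | cons a v ih =>
    rw [wordMask_cons, ← Nat.or_assoc] at h
    rw [archRun_cons, archStep]
    split
    · exact dominated_archRun _ _
    · rename_i hne
      have := or_two_pow_lt (S := S) (τ := τ) (a := a.val) (by omega) (by omega)
      dsimp only at hne ⊢
      exact ih (by omega) h

/-! ### The arch count decides universality -/

lemma isKUniversal_of_le (hσ : 0 < σ) {i j : ℕ} (h : i ≤ j) {v : List (Fin σ)}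
    (hv : IsKUniversal j v) : IsKUniversal i v := by
  intro u hu
  have := hv (u ++ List.replicate (j - i) ⟨0, hσ⟩) (by simp [hu, h])
  exact (List.sublist_append_left _ _).trans this

/-- The form that survives induction over `v`: in the middle of an arch, the words still to be
embedded are those whose first letter is missing from the current arch. A word that starts with a
letter already seen would be easier to embed. -/
lemma le_archRun_iff (hσ : 0 < σ) (v : List (Fin σ)) {c S : ℕ} (hc : c < k)
    (hS : S < 2 ^ σ - 1) :
    k ≤ (archRun σ k (c, S) v).1 ↔
      ∀ u : List (Fin σ), u.length = k - c → (∀ a ∈ u.head?, S.testBit a.val = false) →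
        u.Sublist v := by
  have miss : ∀ T < 2 ^ σ - 1, ∃ a : Fin σ, T.testBit a.val = false := by
    intro T hT
    by_contra! hcon
    have := (eq_full_iff (τ := σ) (S := T) (by omega)).2
      (fun i hi => by simpa using hcon ⟨i, hi⟩)
    omega
  have h1 : 1 < 2 ^ σ := Nat.one_lt_two_pow (by omega)
  induction v generalizing c S with
  | nil =>
    simp only [archRun_nil, List.sublist_nil]
    refine ⟨fun h => by omega, fun h => ?_⟩
    obtain ⟨a, ha⟩ := miss S hS
    have := h (a :: List.replicate (k - c - 1) a) (by simp; omega) (by simpa using ha)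
    simp at this
  | cons b v ih =>
    rw [archRun_cons, archStep]
    have hlt := or_two_pow_lt (S := S) (τ := σ) (a := b.val) (by omega) b.isLt
    split
    · rename_i hfull
      dsimp only at hfull
      -- The letter that closes the arch is the only missing one, so every admissible `u` begins
      -- with it.
      have only : ∀ a : Fin σ, S.testBit a.val = false → a = b := by
        intro a ha
        have := (eq_full_iff hlt).1 hfull a.val a.isLt
        rw [Nat.testBit_or, ha, Bool.false_or, Nat.testBit_two_pow, decide_eq_true_eq] at this
        exact Fin.ext this.symm
      have hb : S.testBit b.val = false := by
        obtain ⟨a, ha⟩ := miss S hS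
        rwa [← only a ha]
      have hbump : bump k c = c + 1 := by unfold bump; rw [if_pos hc]
      dsimp only
      rw [hbump]
      have hiff : (∀ u : List (Fin σ), u.length = k - c →
          (∀ a ∈ u.head?, S.testBit a.val = false) → u.Sublist (b :: v)) ↔
          ∀ u : List (Fin σ), u.length = k - (c + 1) → u.Sublist v := by
        constructor
        · intro h u hu
          have := h (b :: u) (by simp; omega) (by simpa using hb)
          exact List.cons_sublist_cons.1 this
        · intro h u hu hhead
          cases u with
          | nil => simp
          | cons a u =>
            rw [only a (hhead a (by simp))]
            exact List.cons_sublist_cons.2 (h u (by simp at hu; omega))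
      rw [hiff]
      by_cases hck : c + 1 < k
      · have h0 : 0 < 2 ^ σ - 1 := by omega
        refine (ih hck h0).trans ?_
        simp
      · constructor
        · intro _ u hu
          have : u = [] := List.eq_nil_of_length_eq_zero (by omega)
          simp [this]
        · intro _
          exact le_archRun_fst (by dsimp only; omega) v
    · rename_i hfull
      dsimp only at hfull ⊢
      have hS' : S ||| 2 ^ b.val < 2 ^ σ - 1 := by omega
      refine (ih hc hS').trans ?_
      constructor
      · intro h u hu hhead
        cases u with
        | nil => simp
        | cons a u =>
          by_cases hab : a = b
          · subst hab
            apply List.cons_sublist_cons.2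
            -- The letter just read does not close the arch, so some letter `d` is still missing; `d
            -- :: u` embeds into the rest, and so does its tail `u`.
            obtain ⟨d, hd⟩ := miss (S ||| 2 ^ a.val) (by omega)
            have := h (d :: u) (by simpa using hu) (by simpa using hd)
            exact (List.sublist_cons_self _ _).trans this
          · have := h (a :: u) hu (by
              intro a' ha'
              simp only [List.head?_cons, Option.mem_def, Option.some.injEq] at ha'
              subst ha'
              rw [Nat.testBit_or, hhead a (by simp), Bool.false_or, Nat.testBit_two_pow,
                decide_eq_false_iff_not]
              exact fun h => hab (Fin.ext h.symm))
            exact this.trans (List.sublist_cons_self _ _)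
      · intro h u hu hhead
        cases u with
        | nil => simp
        | cons a u =>
          have ha := hhead a (by simp)
          rw [Nat.testBit_or, Bool.or_eq_false_iff, Nat.testBit_two_pow,
            decide_eq_false_iff_not] at ha
          have := h (a :: u) hu (by simpa using ha.1)
          rcases List.sublist_cons_iff.1 this with h' | ⟨r, hr, _⟩
          · exact h'
          · simp only [List.cons.injEq] at hr
            exact absurd (congrArg Fin.val hr.1.symm) ha.2

lemma isKUniversal_iff_le_archRun (hσ : 0 < σ) (v : List (Fin σ)) :
    IsKUniversal k v ↔ k ≤ (archRun σ k (0, 0) v).1 := by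
  have h1 : 1 < 2 ^ σ := Nat.one_lt_two_pow (by omega)
  by_cases hk : 0 < k
  · rw [le_archRun_iff hσ v hk (by omega)]
    simp [IsKUniversal]
  · have : k = 0 := by omega
    subst this
    simp only [Nat.zero_le, iff_true]
    intro u hu
    rw [List.eq_nil_of_length_eq_zero hu]
    simp

/-! ### Bounding the number of arches -/

/-- Concatenate a word missing from `u` with a word missing from `v`. In any embedding into `u ++
v`, either the whole first word falls into `u` or the whole second word falls into `v`. -/
lemma not_isKUniversal_append {i j : ℕ} {u v : List (Fin σ)} (hu : ¬ IsKUniversal i u)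
    (hv : ¬ IsKUniversal j v) : ¬ IsKUniversal (i + j) (u ++ v) := by
  unfold IsKUniversal at hu hv
  push Not at hu hv
  obtain ⟨x, hx, hxu⟩ := hu
  obtain ⟨y, hy, hyv⟩ := hv
  intro h
  have hs := h (x ++ y) (by simp [hx, hy])
  obtain ⟨p, q, hpq, hp, hq⟩ := List.sublist_append_iff.1 hs
  rcases List.append_eq_append_iff.1 hpq with ⟨t, rfl, _⟩ | ⟨t, _, rfl⟩
  · exact hxu ((List.sublist_append_left _ _).trans hp)
  · exact hyv ((List.sublist_append_right _ _).trans hq)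

lemma regexLength_pos (R : RegularExpression (Fin σ)) : 0 < regexLength R := by
  unfold regexLength
  induction R <;> simp_all [regexString]

lemma isKUniversal_one_iff {v : List (Fin σ)} : IsKUniversal 1 v ↔ ∀ a, a ∈ v := by
  constructor
  · intro h a
    simpa using h [a] rfl
  · intro h u hu
    obtain ⟨a, rfl⟩ := List.length_eq_one_iff.1 hu
    simpa using h a

lemma append_mem_kstar {L : Language (Fin σ)} {u v : List (Fin σ)} (hu : u ∈ L∗)
    (hv : v ∈ L∗) : u ++ v ∈ L∗ := by
  rw [← kstar_mul_kstar L]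
  exact Language.append_mem_mul hu hv

lemma nil_mem_kstar (L : Language (Fin σ)) : [] ∈ L∗ := Language.nil_mem_kstar L

lemma mem_kstar_of_mem {L : Language (Fin σ)} {v : List (Fin σ)} (hv : v ∈ L) : v ∈ L∗ := by
  have : L ≤ L∗ := le_kstar
  exact this hv

lemma isKUniversal_append {i j : ℕ} {u v : List (Fin σ)} (hu : IsKUniversal i u)
    (hv : IsKUniversal j v) : IsKUniversal (i + j) (u ++ v) := by
  intro w hw
  rw [← List.take_append_drop i w]
  exact (hu _ (by simp; omega)).append (hv _ (by simp; omega))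

/-- A word of a star contains all letters of the language, one of its powers is universal. -/
lemma exists_kstar_of_letters {L : Language (Fin σ)} (h : ∀ a, ∃ v ∈ L, a ∈ v) :
    ∀ k, ∃ v ∈ L∗, IsKUniversal k v := by
  have h1 : ∃ v ∈ L∗, ∀ a, a ∈ v := by
    have : ∀ l : List (Fin σ), ∃ v ∈ L∗, ∀ a ∈ l, a ∈ v := by
      intro l
      induction l with
      | nil => exact ⟨[], nil_mem_kstar L, by simp⟩
      | cons a l ih =>
        obtain ⟨v, hv, hl⟩ := ih
        obtain ⟨u, hu, hau⟩ := h a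
        refine ⟨u ++ v, append_mem_kstar (mem_kstar_of_mem hu) hv, ?_⟩
        intro b hb
        rcases List.mem_cons.1 hb with rfl | hb
        · simp [hau]
        · simp [hl b hb]
    obtain ⟨v, hv, hl⟩ := this (List.finRange σ)
    exact ⟨v, hv, fun a => hl a (by simp)⟩
  obtain ⟨v, hv, hall⟩ := h1
  intro k
  induction k with
  | zero => exact ⟨[], nil_mem_kstar L, by intro u hu; simp [List.eq_nil_of_length_eq_zero hu]⟩
  | succ k ih =>
    obtain ⟨u, hu, huk⟩ := ih
    exact ⟨u ++ v, append_mem_kstar hu hv,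
      isKUniversal_append huk (isKUniversal_one_iff.2 hall)⟩

/-- Either all universality indices occur in the language of a regular expression, or they are
less than twice its length. -/
lemma exists_all_or_not_isKUniversal (hσ : 0 < σ) (R : RegularExpression (Fin σ)) :
    (∀ k, ExistsKUniversal k R.matches') ∨
      ∀ v ∈ R.matches', ¬ IsKUniversal (2 * regexLength R) v := by
  induction R with
  | zero => exact Or.inr fun v hv => absurd hv (Language.notMem_zero v)
  | epsilon =>
    right
    intro v hv h
    simp [RegularExpression.matches'] at hv
    subst hv
    have := h [⟨0, hσ⟩, ⟨0, hσ⟩] rfl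
    simp at this
  | char a =>
    right
    intro v hv h
    simp [RegularExpression.matches'] at hv
    change v = [a] at hv
    subst hv
    -- Over a one-letter alphabet a single letter is already `1`-universal, so only index `2` is
    -- excluded; this is where the factor `2` comes from.
    have := (h [⟨0, hσ⟩, ⟨0, hσ⟩] rfl).length_le
    simp at this
  | plus R₁ R₂ ih₁ ih₂ =>
    rcases ih₁ with ih₁ | ih₁
    · left
      intro k
      obtain ⟨v, hv, h⟩ := ih₁ k
      exact ⟨v, Or.inl hv, h⟩
    rcases ih₂ with ih₂ | ih₂
    · left
      intro k
      obtain ⟨v, hv, h⟩ := ih₂ k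
      exact ⟨v, Or.inr hv, h⟩
    right
    intro v hv h
    rcases hv with hv | hv
    · exact ih₁ v hv (isKUniversal_of_le hσ (by simp [regexLength, regexString]; omega) h)
    · exact ih₂ v hv (isKUniversal_of_le hσ (by simp [regexLength, regexString]; omega) h)
  | comp R₁ R₂ ih₁ ih₂ =>
    -- If one factor is empty then so is the product, however universal the other factor is.
    by_cases hne : (∃ v, v ∈ R₁.matches') ∧ ∃ v, v ∈ R₂.matches'
    swap
    · right
      intro v hv
      obtain ⟨x, hx, y, hy, -⟩ := Language.mem_mul.1 hv
      exact absurd ⟨⟨x, hx⟩, ⟨y, hy⟩⟩ hne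
    obtain ⟨⟨x, hx⟩, ⟨y, hy⟩⟩ := hne
    rcases ih₁ with ih₁ | ih₁
    · left
      intro k
      obtain ⟨v, hv, h⟩ := ih₁ k
      exact ⟨v ++ y, Language.append_mem_mul hv hy,
        fun u hu => (h u hu).trans (List.sublist_append_left _ _)⟩
    rcases ih₂ with ih₂ | ih₂
    · left
      intro k
      obtain ⟨v, hv, h⟩ := ih₂ k
      exact ⟨x ++ v, Language.append_mem_mul hx hv,
        fun u hu => (h u hu).trans (List.sublist_append_right _ _)⟩
    right
    intro v hv h
    obtain ⟨x, hx, y, hy, rfl⟩ := Language.mem_mul.1 hv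
    refine not_isKUniversal_append (ih₁ x hx) (ih₂ y hy) ?_
    convert h using 1
    simp [regexLength, regexString]
    ring
  | star R ih =>
    by_cases hall : ∀ a, ∃ v ∈ R.matches', a ∈ v
    · left
      exact exists_kstar_of_letters hall
    · right
      push Not at hall
      obtain ⟨a, ha⟩ := hall
      intro v hv h
      -- A letter that is missing from the language is missing from its star, so not even index `1`
      -- is possible.
      have h1 : IsKUniversal 1 v :=
        isKUniversal_of_le hσ (by have := regexLength_pos (RegularExpression.star R); omega) h
      have hav := isKUniversal_one_iff.1 h1 a
      obtain ⟨l, rfl, hl⟩ := Language.mem_kstar.1 hv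
      obtain ⟨y, hy, hay⟩ := List.mem_flatten.1 hav
      exact ha y (hl y hy) hay

/-- Reaching index `2 * regexLength R` already shows that the indices are unbounded. The cap keeps
the stored counts small. -/
lemma existsKUniversal_min_iff (hσ : 0 < σ) (R : RegularExpression (Fin σ)) (k : ℕ) :
    ExistsKUniversal (min k (2 * regexLength R)) R.matches' ↔ ExistsKUniversal k R.matches' := by
  constructor
  · rintro ⟨v, hv, h⟩
    rcases exists_all_or_not_isKUniversal hσ R with hall | hnot
    · exact hall k
    · rcases le_total k (2 * regexLength R) with hk | hk
      · rw [min_eq_left hk] at h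
        exact ⟨v, hv, h⟩
      · rw [min_eq_right hk] at h
        exact absurd h (hnot v hv)
  · rintro ⟨v, hv, h⟩
    exact ⟨v, hv, isKUniversal_of_le hσ (min_le_left _ _) h⟩

end

section

open scoped Computability

variable {σ τ k : ℕ}

/-! ### Tables of states -/

/-- The table `D` holds the state `x`: the entry at a set of letters is the successor of the
number of arches, or `0` if there is no state with this set of letters. -/
def HasState (τ : ℕ) (D : ℕ → ℕ) (x : ℕ × ℕ) : Prop :=
  x.2 < 2 ^ τ - 1 ∧ D x.2 = x.1 + 1

/-- The states in `D'` are, up to domination, those reached from the states in `D` by reading a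
word of `L`. -/
structure Transfers (τ k : ℕ) (D : ℕ → ℕ) (L : Language (Fin σ)) (D' : ℕ → ℕ) : Prop where
  full : D' (2 ^ τ - 1) = 0
  sound : ∀ y, HasState τ D' y →
    ∃ x, HasState τ D x ∧ ∃ v ∈ L, Dominated k y (archRun τ k x v)
  complete : ∀ x, HasState τ D x → ∀ v ∈ L,
    ∃ y, HasState τ D' y ∧ Dominated k (archRun τ k x v) y

/-- `D₁` arises from `D` by adding the letters in `A` to all states. -/
structure AddsLetters (τ A : ℕ) (D D₁ : ℕ → ℕ) : Prop where
  le : ∀ S < 2 ^ τ, D S ≤ D₁ (S ||| A)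
  exists_eq : ∀ T < 2 ^ τ, D₁ T ≠ 0 → ∃ S < 2 ^ τ, S ||| A = T ∧ D S = D₁ T

/-- `D'` arises from `D₁` by completing the arch of the states with all letters, with remainder
`B`. -/
structure CompletesArch (τ k B : ℕ) (D₁ D' : ℕ → ℕ) : Prop where
  full : D' (2 ^ τ - 1) = 0
  sound : ∀ y, HasState τ D' y →
    HasState τ D₁ y ∨ ∃ c, D₁ (2 ^ τ - 1) = c + 1 ∧ y = (bump k c, B)
  keep : ∀ x, HasState τ D₁ x → ∃ y, HasState τ D' y ∧ Dominated k x y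
  complete : ∀ c, D₁ (2 ^ τ - 1) = c + 1 → ∃ y, HasState τ D' y ∧ Dominated k (bump k c, B) y

lemma HasState.congr {D D' : ℕ → ℕ} (h : ∀ S < 2 ^ τ, D S = D' S) {x : ℕ × ℕ}
    (hx : HasState τ D x) : HasState τ D' x :=
  ⟨hx.1, by rw [← h _ (by have := hx.1; omega)]; exact hx.2⟩

lemma two_pow_sub_one_lt (τ : ℕ) : 2 ^ τ - 1 < 2 ^ τ := Nat.sub_lt (by positivity) one_pos

lemma Transfers.congr {D₁ D₁' D₂ D₂' : ℕ → ℕ} {L : Language (Fin σ)}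
    (h : Transfers τ k D₁ L D₂) (h₁ : ∀ S < 2 ^ τ, D₁' S = D₁ S)
    (h₂ : ∀ S < 2 ^ τ, D₂' S = D₂ S) : Transfers τ k D₁' L D₂' where
  full := by rw [h₂ _ (two_pow_sub_one_lt τ), h.full]
  sound y hy := by
    obtain ⟨x, hx, v, hv, hd⟩ := h.sound y (hy.congr h₂)
    exact ⟨x, hx.congr fun S hS => (h₁ S hS).symm, v, hv, hd⟩
  complete x hx v hv := by
    obtain ⟨y, hy, hd⟩ := h.complete x (hx.congr h₁) v hv
    exact ⟨y, hy.congr fun S hS => (h₂ S hS).symm, hd⟩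

lemma Transfers.one {D : ℕ → ℕ} (h : D (2 ^ τ - 1) = 0) :
    Transfers τ k D (1 : Language (Fin σ)) D where
  full := h
  sound y hy := ⟨y, hy, [], Language.nil_mem_one, Dominated.refl _⟩
  complete x hx v hv := by
    rw [Language.mem_one] at hv
    subst hv
    exact ⟨x, hx, Dominated.refl _⟩

lemma Transfers.zero {D D' : ℕ → ℕ} (h : ∀ S < 2 ^ τ, D' S = 0) :
    Transfers τ k D (0 : Language (Fin σ)) D' where
  full := h _ (two_pow_sub_one_lt τ)
  sound y hy := by
    have h1 := hy.2
    rw [h _ (by have := hy.1; omega)] at h1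
    omega
  complete x hx v hv := absurd hv (Language.notMem_zero v)

/-- The intermediate table holds representatives only up to domination; monotonicity of reading
allows a state to be replaced by its representative before the second word is read. -/
lemma Transfers.mul (hτ : 0 < τ) (hστ : σ ≤ τ) {D D₁ D₂ : ℕ → ℕ} {L M : Language (Fin σ)}
    (h₁ : Transfers τ k D L D₁) (h₂ : Transfers τ k D₁ M D₂) :
    Transfers τ k D (L * M) D₂ where
  full := h₂.full
  sound y hy := by
    obtain ⟨x, hx, v, hv, hd⟩ := h₂.sound y hy
    obtain ⟨z, hz, u, hu, hd'⟩ := h₁.sound x hx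
    refine ⟨z, hz, u ++ v, Language.append_mem_mul hu hv, ?_⟩
    rw [archRun_append]
    exact hd.trans (archRun_mono hτ hστ (archRun_snd_lt hτ hστ hz.1 u) hd' v)
  complete x hx w hw := by
    obtain ⟨u, hu, v, hv, rfl⟩ := Language.mem_mul.1 hw
    obtain ⟨y, hy, hd⟩ := h₁.complete x hx u hu
    obtain ⟨z, hz, hd'⟩ := h₂.complete y hy v hv
    refine ⟨z, hz, ?_⟩
    rw [archRun_append]
    exact (archRun_mono hτ hστ hy.1 hd v).trans hd'

/-- For a fixed set of letters the larger count dominates the smaller one, so the entry that is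
overwritten is not needed. -/
lemma Transfers.add {D D₁ D₂ D' : ℕ → ℕ} {L M : Language (Fin σ)}
    (h₁ : Transfers τ k D L D₁) (h₂ : Transfers τ k D M D₂)
    (h : ∀ S < 2 ^ τ, D' S = max (D₁ S) (D₂ S)) : Transfers τ k D (L + M) D' where
  full := by rw [h _ (two_pow_sub_one_lt τ), h₁.full, h₂.full, max_self]
  sound y hy := by
    have hy2 := hy.2
    rw [h _ (by have := hy.1; omega)] at hy2
    rcases max_choice (D₁ y.2) (D₂ y.2) with hm | hm
    · obtain ⟨x, hx, v, hv, hd⟩ := h₁.sound y ⟨hy.1, by rw [← hm, hy2]⟩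
      exact ⟨x, hx, v, Or.inl hv, hd⟩
    · obtain ⟨x, hx, v, hv, hd⟩ := h₂.sound y ⟨hy.1, by rw [← hm, hy2]⟩
      exact ⟨x, hx, v, Or.inr hv, hd⟩
  complete x hx v hv := by
    have key : ∀ y : ℕ × ℕ, y.2 < 2 ^ τ - 1 → (D₁ y.2 = y.1 + 1 ∨ D₂ y.2 = y.1 + 1) →
        ∃ z, HasState τ D' z ∧ Dominated k y z := by
      intro y hy1 hy2
      refine ⟨(max (D₁ y.2) (D₂ y.2) - 1, y.2), ⟨hy1, ?_⟩, ?_⟩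
      · rw [h _ (by omega)]
        dsimp only
        have := le_max_left (D₁ y.2) (D₂ y.2)
        have := le_max_right (D₁ y.2) (D₂ y.2)
        omega
      · refine Dominated.of_le (c := y.1) (S := y.2) ?_
        have := le_max_left (D₁ y.2) (D₂ y.2)
        have := le_max_right (D₁ y.2) (D₂ y.2)
        omega
    rcases hv with hv | hv
    · obtain ⟨y, hy, hd⟩ := h₁.complete x hx v hv
      obtain ⟨z, hz, hd'⟩ := key y hy.1 (Or.inl hy.2)
      exact ⟨z, hz, hd.trans hd'⟩
    · obtain ⟨y, hy, hd⟩ := h₂.complete x hx v hv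
      obtain ⟨z, hz, hd'⟩ := key y hy.1 (Or.inr hy.2)
      exact ⟨z, hz, hd.trans hd'⟩

lemma AddsLetters.exists_of_eq_succ {A : ℕ} {D D₁ : ℕ → ℕ} (h : AddsLetters τ A D D₁)
    (hD : D (2 ^ τ - 1) = 0) {c T : ℕ} (hT : T < 2 ^ τ) (h1 : D₁ T = c + 1) :
    ∃ S, HasState τ D (c, S) ∧ S ||| A = T := by
  obtain ⟨S, hS, hSA, hDS⟩ := h.exists_eq T hT (by omega)
  refine ⟨S, ⟨?_, by dsimp only; omega⟩, hSA⟩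
  dsimp only
  by_contra hn
  have : S = 2 ^ τ - 1 := by omega
  rw [this] at hDS
  omega

lemma AddsLetters.exists_of_hasState {A : ℕ} {D D₁ : ℕ → ℕ} (h : AddsLetters τ A D D₁)
    {c S : ℕ} (hx : HasState τ D (c, S)) : ∃ d, c ≤ d ∧ D₁ (S ||| A) = d + 1 := by
  have h1 := hx.1
  have h2 := hx.2
  dsimp only at h1 h2
  have h3 := h.le S (by omega)
  exact ⟨D₁ (S ||| A) - 1, by omega, by omega⟩

/-- The closed form in which a table is updated. Entries exceed counts by one, so the test against
`k + 1` is the test of the count against the cap. -/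
lemma CompletesArch.of_eq {B : ℕ} {D₁ D' : ℕ → ℕ} (hB : B < 2 ^ τ - 1)
    (h : ∀ S < 2 ^ τ, D' S = if S = 2 ^ τ - 1 then 0 else
      if S = B ∧ D₁ (2 ^ τ - 1) ≠ 0 then
        max (D₁ B) (if D₁ (2 ^ τ - 1) < k + 1 then D₁ (2 ^ τ - 1) + 1 else D₁ (2 ^ τ - 1))
      else D₁ S) : CompletesArch τ k B D₁ D' := by
  have hbump : ∀ c, (if c + 1 < k + 1 then c + 1 + 1 else c + 1) = bump k c + 1 := by
    intro c; unfold bump; split <;> split <;> omega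
  refine ⟨?_, ?_, ?_, ?_⟩
  · rw [h _ (two_pow_sub_one_lt τ), if_pos rfl]
  · rintro ⟨c, S⟩ ⟨h1, h2⟩
    dsimp only at h1 h2
    rw [h S (by omega), if_neg (by omega)] at h2
    split at h2
    · rename_i hS
      obtain ⟨d, hd⟩ := Nat.exists_eq_succ_of_ne_zero hS.2
      rw [hd, Nat.succ_eq_add_one, hbump] at h2
      rcases max_choice (D₁ B) (bump k d + 1) with hm | hm
      · left
        exact ⟨h1, by dsimp only; rw [hS.1]; omega⟩
      · right
        refine ⟨d, hd, ?_⟩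
        rw [hS.1]
        congr 1
        omega
    · exact Or.inl ⟨h1, h2⟩
  · rintro ⟨c, S⟩ ⟨h1, h2⟩
    dsimp only at h1 h2
    have h3 := h S (by omega)
    rw [if_neg (by omega)] at h3
    refine ⟨(D' S - 1, S), ⟨h1, ?_⟩, Dominated.of_le ?_⟩
    all_goals
      try dsimp only
      split at h3
      · rename_i hS
        rw [hS.1] at h2 h3 ⊢
        have := le_max_left (D₁ B) (if D₁ (2 ^ τ - 1) < k + 1 then D₁ (2 ^ τ - 1) + 1
          else D₁ (2 ^ τ - 1))
        omega
      · omega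
  · intro c hc
    have h3 := h B (by omega)
    rw [if_neg (by omega), if_pos ⟨rfl, by omega⟩, hc, hbump] at h3
    have := le_max_right (D₁ B) (bump k c + 1)
    exact ⟨(D' B - 1, B), ⟨hB, by dsimp only; omega⟩, Dominated.of_le (by omega)⟩

lemma Transfers.char (hστ : σ ≤ τ) {D D₁ D' : ℕ → ℕ} {a : Fin σ}
    (hD : D (2 ^ τ - 1) = 0) (h₁ : AddsLetters τ (2 ^ a.val) D D₁)
    (h₂ : CompletesArch τ k 0 D₁ D') : Transfers τ k D ({[a]} : Language (Fin σ)) D' where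
  full := h₂.full
  sound y hy := by
    rcases h₂.sound y hy with h | ⟨c, hc, rfl⟩
    · obtain ⟨S, hS, hSa⟩ := h₁.exists_of_eq_succ hD (by have := h.1; omega) h.2
      refine ⟨_, hS, [a], rfl, ?_⟩
      have hne : S ||| 2 ^ a.val ≠ 2 ^ τ - 1 := by have := h.1; omega
      rw [archRun_cons, archRun_nil, archStep, if_neg hne, hSa]
      exact Dominated.refl _
    · obtain ⟨S, hS, hSa⟩ := h₁.exists_of_eq_succ hD (two_pow_sub_one_lt τ) hc
      refine ⟨_, hS, [a], rfl, ?_⟩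
      rw [archRun_cons, archRun_nil, archStep, if_pos hSa]
      exact Dominated.refl _
  complete := by
    rintro ⟨c, S⟩ hx v hv
    change v = [a] at hv
    subst hv
    obtain ⟨d, hcd, hd⟩ := h₁.exists_of_hasState hx
    have hS := hx.1
    dsimp only at hS
    rw [archRun_cons, archRun_nil, archStep]
    dsimp only
    split
    · rename_i hfull
      rw [hfull] at hd
      obtain ⟨y, hy, hdy⟩ := h₂.complete d hd
      refine ⟨y, hy, Dominated.trans (Dominated.of_le ?_) hdy⟩
      unfold bump
      split <;> split <;> omega
    · rename_i hne
      have := or_two_pow_lt (S := S) (τ := τ) (a := a.val) (by omega) (by omega)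
      obtain ⟨y, hy, hdy⟩ := h₂.keep (d, S ||| 2 ^ a.val) ⟨by dsimp only; omega, hd⟩
      exact ⟨y, hy, (Dominated.of_le hcd).trans hdy⟩

/-- Words over a proper subset `A` of the letters can close only the arch that is already open. Some
word `v` of the star has exactly the letters `A`; it realises the best outcome if `S ∪ A` is not
full, and `v ++ v` does if it is full. -/
lemma Transfers.star_of_ne_full (hτ : 0 < τ) (hστ : σ ≤ τ) {D D₁ D' : ℕ → ℕ} {A : ℕ}
    {L : Language (Fin σ)} (hA : A < 2 ^ τ - 1) (hex : ∃ v ∈ L∗, wordMask v = A)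
    (hle : ∀ v ∈ L∗, wordMask v ||| A = A)
    (hD : D (2 ^ τ - 1) = 0) (h₁ : AddsLetters τ A D D₁)
    (h₂ : CompletesArch τ k A D₁ D') : Transfers τ k D L∗ D' := by
  obtain ⟨v, hv, rfl⟩ := hex
  refine ⟨h₂.full, ?_, ?_⟩
  · intro y hy
    rcases h₂.sound y hy with h | ⟨c, hc, rfl⟩
    · obtain ⟨S, hS, hSa⟩ := h₁.exists_of_eq_succ hD (by have := h.1; omega) h.2
      refine ⟨_, hS, v, hv, ?_⟩
      rw [archRun_eq hστ (by have := hS.1; dsimp only at this; omega) v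
        (by have := h.1; omega), hSa]
      exact Dominated.refl _
    · obtain ⟨S, hS, hSa⟩ := h₁.exists_of_eq_succ hD (two_pow_sub_one_lt τ) hc
      -- The first copy closes the arch, the second one collects all of `A` in the next arch.
      refine ⟨_, hS, v ++ v, append_mem_kstar hv hv, ?_⟩
      have hd := dominated_archRun_of_full (k := k) (c := c) hστ hS.1 v hSa
      have hm := archRun_mono hτ hστ (archRun_snd_lt hτ hστ hS.1 v) hd v
      rw [archRun_append]
      rwa [archRun_eq hστ (by omega) v (by rw [Nat.zero_or]; omega), Nat.zero_or] at hm
  · rintro ⟨c, S⟩ hx u hu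
    obtain ⟨d, hcd, hd⟩ := h₁.exists_of_hasState hx
    have hS := hx.1
    dsimp only at hS
    by_cases hne : S ||| wordMask v = 2 ^ τ - 1
    · rw [hne] at hd
      obtain ⟨y, hy, hdy⟩ := h₂.complete d hd
      refine ⟨y, hy, Dominated.trans ?_ hdy⟩
      have hcd' : bump k c ≤ bump k d := by unfold bump; split <;> split <;> omega
      refine Dominated.trans (y := (bump k c, wordMask v)) ?_ (Dominated.of_le hcd')
      -- While letters of `A` are read, either no arch has been counted yet or the state is below
      -- `(bump k c, A)`. The latter state is fixed by these letters, because `A` is not full.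
      have inv : ∀ w : List (Fin σ), wordMask w ||| wordMask v = wordMask v → ∀ z : ℕ × ℕ,
          (z.1 = c ∨ Dominated k z (bump k c, wordMask v)) →
          ((archRun τ k z w).1 = c ∨ Dominated k (archRun τ k z w) (bump k c, wordMask v)) := by
        intro w
        induction w with
        | nil => exact fun _ z hz => hz
        | cons a w ih =>
          intro hw z hz
          rw [wordMask_cons, or_eq_right_iff] at hw
          have hw' : wordMask w ||| wordMask v = wordMask v := by
            rw [or_eq_right_iff]
            intro i hi
            exact hw i (by rw [Nat.testBit_or, hi, Bool.or_true])
          have ha : wordMask v ||| 2 ^ a.val = wordMask v := by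
            rw [Nat.or_comm, or_eq_right_iff]
            intro i hi
            exact hw i (by rw [Nat.testBit_or, hi, Bool.true_or])
          refine ih hw' (archStep τ k a.val z) ?_
          rcases hz with hz | hz
          · unfold archStep
            split
            · right
              rw [hz]
              right; right
              exact ⟨rfl, Nat.zero_or _⟩
            · exact Or.inl hz
          · right
            have := archStep_mono (a := a.val) (τ := τ) (by omega) hA hz
            have hstep : archStep τ k a.val (bump k c, wordMask v) = (bump k c, wordMask v) := by
              unfold archStep
              dsimp only
              rw [ha, if_neg (by omega)]
            rwa [hstep] at this
      rcases inv u (hle u hu) (c, S) (Or.inl rfl) with h | h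
      · have h' : archRun τ k (c, S) u = (c, (archRun τ k (c, S) u).2) := Prod.ext h rfl
        rw [h']
        exact dominated_bump
      · exact h
    · have hor := Nat.or_lt_two_pow (x := S) (y := wordMask v) (n := τ) (by omega) (by omega)
      obtain ⟨y, hy, hdy⟩ := h₂.keep (d, S ||| wordMask v) ⟨by dsimp only; omega, hd⟩
      refine ⟨y, hy, Dominated.trans ?_ hdy⟩
      refine Dominated.trans (y := (c, S ||| wordMask v)) ?_ (Dominated.of_le hcd)
      have hsub : (S ||| wordMask u) ||| (S ||| wordMask v) = S ||| wordMask v := by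
        have h3 := hle u hu
        rw [or_eq_right_iff] at h3 ⊢
        intro i hi
        rw [Nat.testBit_or, Bool.or_eq_true] at hi ⊢
        exact hi.imp id (h3 i)
      rw [archRun_eq hστ (by omega) u]
      · right; right
        exact ⟨rfl, hsub⟩
      · intro hfull
        rw [hfull, full_or hor] at hsub
        exact hne hsub.symm

/-- Each further copy of a word with all letters closes at least one arch. -/
lemma exists_le_archRun_of_full (hτ : 0 < τ) (hστ : σ ≤ τ) {L : Language (Fin σ)}
    (hex : ∃ v ∈ L∗, wordMask v = 2 ^ τ - 1) (x : ℕ × ℕ) (hx : x.2 < 2 ^ τ - 1) :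
    ∃ v ∈ L∗, k ≤ (archRun τ k x v).1 := by
  obtain ⟨v, hv, hfull⟩ := hex
  have : ∀ j, j ≤ k → ∃ v ∈ L∗, j ≤ (archRun τ k x v).1 := by
    intro j
    induction j with
    | zero => exact fun _ => ⟨[], nil_mem_kstar L, Nat.zero_le _⟩
    | succ j ih =>
      intro hj
      obtain ⟨u, hu, hju⟩ := ih (by omega)
      refine ⟨u ++ v, append_mem_kstar hu hv, ?_⟩
      have hy := archRun_snd_lt (k := k) hτ hστ hx u
      rw [archRun_append]
      have hd := dominated_archRun_of_full (k := k) (c := (archRun τ k x u).1) hστ hy v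
        (by rw [Nat.or_comm, hfull, full_or (by omega)])
      have hb : j + 1 ≤ bump k (archRun τ k x u).1 := by unfold bump; split <;> omega
      rcases hd with h | h | h
      · exact hj.trans h
      · exact hb.trans h.le
      · exact hb.trans h.1.le
  exact this k le_rfl

/-- Adding all letters gathers every state at the full set. Writing `k + 1` there stands for the
count `k`, which closing the arch no longer raises, so the capped count is left at the empty set. -/
lemma Transfers.star_of_full (hτ : 0 < τ) (hστ : σ ≤ τ) {D D₁ D₂ D' : ℕ → ℕ}
    {L : Language (Fin σ)} (hex : ∃ v ∈ L∗, wordMask v = 2 ^ τ - 1)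
    (hD : D (2 ^ τ - 1) = 0) (h₁ : AddsLetters τ (2 ^ τ - 1) D D₁)
    (hlt : ∀ S < 2 ^ τ - 1, D₂ S = D₁ S)
    (hfull : D₂ (2 ^ τ - 1) = if D₁ (2 ^ τ - 1) = 0 then 0 else k + 1)
    (h₂ : CompletesArch τ k 0 D₂ D') : Transfers τ k D L∗ D' where
  full := h₂.full
  sound y hy := by
    rcases h₂.sound y hy with h | ⟨c, hc, rfl⟩
    · have h' : HasState τ D₁ y := ⟨h.1, by rw [← hlt _ h.1]; exact h.2⟩
      obtain ⟨S, hS, hSa⟩ := h₁.exists_of_eq_succ hD (by have := h.1; omega) h'.2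
      have := hS.1
      dsimp only at this
      rw [Nat.or_comm, full_or (by omega)] at hSa
      have := h.1
      omega
    · rw [hfull] at hc
      split at hc
      · omega
      · rename_i hne
        obtain ⟨d, hd⟩ := Nat.exists_eq_succ_of_ne_zero hne
        obtain ⟨S, hS, -⟩ := h₁.exists_of_eq_succ hD (two_pow_sub_one_lt τ) hd
        obtain ⟨v, hv, hk⟩ := exists_le_archRun_of_full (k := k) hτ hστ hex _ hS.1
        exact ⟨_, hS, v, hv, Or.inl hk⟩
  complete := by
    rintro ⟨c, S⟩ hx v hv
    obtain ⟨d, hcd, hd⟩ := h₁.exists_of_hasState hx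
    have hS := hx.1
    dsimp only at hS
    rw [Nat.or_comm, full_or (by omega)] at hd
    rw [hd, if_neg (by omega)] at hfull
    obtain ⟨y, hy, hdy⟩ := h₂.complete k hfull
    refine ⟨y, hy, Dominated.trans (Or.inl ?_) hdy⟩
    exact bump_ge k k

/-! ### Letters of a language -/

/-- `x` describes which letters occur in `L`; bit `τ` tells whether `L` is nonempty. -/
structure LetterMask (τ : ℕ) (L : Language (Fin σ)) (x : ℕ) : Prop where
  lt : x < 2 ^ (τ + 1)
  nonempty : x.testBit τ = true ↔ ∃ v, v ∈ L
  letters : ∀ i < τ, x.testBit i = true ↔ ∃ v ∈ L, ∃ a ∈ v, a.val = i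

/-- The purpose of bit `τ`: it separates the empty language, with mask `0`, from the language of the
empty word. -/
lemma LetterMask.ne_zero_iff {L : Language (Fin σ)} {x : ℕ} (h : LetterMask τ L x) :
    x ≠ 0 ↔ ∃ v, v ∈ L := by
  rw [← h.nonempty]
  constructor
  · intro hx
    obtain ⟨i, hi⟩ := Nat.exists_testBit_of_ne_zero hx
    have hiτ : i < τ + 1 := by
      by_contra hn
      rw [Nat.testBit_lt_two_pow (lt_of_lt_of_le h.lt
        (Nat.pow_le_pow_right (by simp) (by omega)))] at hi
      simp at hi
    by_cases h' : i < τ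
    · obtain ⟨v, hv, -⟩ := (h.letters i h').1 hi
      exact h.nonempty.2 ⟨v, hv⟩
    · have : i = τ := by omega
      rwa [← this]
  · rintro hx rfl
    simp at hx

lemma LetterMask.zero : LetterMask τ (0 : Language (Fin σ)) 0 where
  lt := by positivity
  nonempty := by simp [Language.notMem_zero]
  letters := by simp [Language.notMem_zero]

lemma LetterMask.one : LetterMask τ (1 : Language (Fin σ)) (2 ^ τ) where
  lt := Nat.pow_lt_pow_right (by simp) (by omega)
  nonempty := by simp [Language.mem_one]
  letters i hi := by
    have : τ ≠ i := by omega
    simp [Language.mem_one, this]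

lemma LetterMask.add {L M : Language (Fin σ)} {x y : ℕ} (hx : LetterMask τ L x)
    (hy : LetterMask τ M y) : LetterMask τ (L + M) (x ||| y) where
  lt := Nat.or_lt_two_pow hx.lt hy.lt
  nonempty := by
    rw [Nat.testBit_or, Bool.or_eq_true, hx.nonempty, hy.nonempty]
    simp only [Language.mem_add]
    exact exists_or.symm
  letters i hi := by
    rw [Nat.testBit_or, Bool.or_eq_true, hx.letters i hi, hy.letters i hi]
    simp only [Language.mem_add, or_and_right]
    exact exists_or.symm

/-- If both factors are nonempty, every word of one factor extends to a word of the product, so no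
letter is lost. If one is empty, all letters are. -/
lemma LetterMask.mul {L M : Language (Fin σ)} {x y : ℕ} (hx : LetterMask τ L x)
    (hy : LetterMask τ M y) :
    LetterMask τ (L * M) (if x = 0 ∨ y = 0 then 0 else x ||| y) := by
  by_cases h : x = 0 ∨ y = 0
  · rw [if_pos h]
    have : L * M = 0 := by
      ext w
      simp only [Language.notMem_zero, iff_false]
      intro hw
      obtain ⟨u, hu, v, hv, -⟩ := Language.mem_mul.1 hw
      exact h.elim (hx.ne_zero_iff.2 ⟨u, hu⟩) (hy.ne_zero_iff.2 ⟨v, hv⟩)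
    rw [this]
    exact LetterMask.zero
  · rw [if_neg h]
    push Not at h
    obtain ⟨u, hu⟩ := hx.ne_zero_iff.1 h.1
    obtain ⟨v, hv⟩ := hy.ne_zero_iff.1 h.2
    refine ⟨Nat.or_lt_two_pow hx.lt hy.lt, ?_, ?_⟩
    · rw [Nat.testBit_or, Bool.or_eq_true, hx.nonempty]
      exact iff_of_true (Or.inl ⟨u, hu⟩) ⟨u ++ v, Language.append_mem_mul hu hv⟩
    · intro i hi
      rw [Nat.testBit_or, Bool.or_eq_true, hx.letters i hi, hy.letters i hi]
      constructor
      · rintro (⟨w, hw, a, ha, hai⟩ | ⟨w, hw, a, ha, hai⟩)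
        · exact ⟨w ++ v, Language.append_mem_mul hw hv, a, by simp [ha], hai⟩
        · exact ⟨u ++ w, Language.append_mem_mul hu hw, a, by simp [ha], hai⟩
      · rintro ⟨w, hw, a, ha, hai⟩
        obtain ⟨p, hp, q, hq, rfl⟩ := Language.mem_mul.1 hw
        rcases List.mem_append.1 ha with ha | ha
        · exact Or.inl ⟨p, hp, a, ha, hai⟩
        · exact Or.inr ⟨q, hq, a, ha, hai⟩

lemma LetterMask.mul_char {L : Language (Fin σ)} {x : ℕ} (hστ : σ ≤ τ) (hx : LetterMask τ L x)
    (a : Fin σ) : LetterMask τ (L * {[a]}) (if x = 0 then 0 else x ||| 2 ^ a.val) := by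
  have hmem : ∀ v : List (Fin σ), v ∈ ({[a]} : Language (Fin σ)) ↔ v = [a] := fun _ => Iff.rfl
  have ha : LetterMask τ ({[a]} : Language (Fin σ)) (2 ^ τ ||| 2 ^ a.val) := by
    refine ⟨Nat.or_lt_two_pow (Nat.pow_lt_pow_right (by simp) (by omega))
      (Nat.pow_lt_pow_right (by simp) (by omega)), ?_, ?_⟩
    · simp [hmem]
    · intro i hi
      have : τ ≠ i := by omega
      simp [hmem, Nat.testBit_two_pow, this]
  have hpos : 2 ^ τ ||| 2 ^ a.val ≠ 0 := ha.ne_zero_iff.2 ⟨[a], rfl⟩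
  convert hx.mul ha using 1
  by_cases h : x = 0
  · simp [h]
  · rw [if_neg h, if_neg (by tauto), ← Nat.or_assoc]
    congr 1
    -- The nonemptiness bit is already set in the nonzero mask `x`.
    rw [eq_comm, Nat.or_comm, or_eq_right_iff]
    intro i hi
    rw [Nat.testBit_two_pow, decide_eq_true_eq] at hi
    rw [← hi]
    exact hx.nonempty.2 (hx.ne_zero_iff.1 h)

lemma exists_mem_of_mem_kstar {L : Language (Fin σ)} {v : List (Fin σ)} (hv : v ∈ L∗)
    {a : Fin σ} (ha : a ∈ v) : ∃ u ∈ L, a ∈ u := by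
  obtain ⟨l, rfl, hl⟩ := Language.mem_kstar.1 hv
  obtain ⟨u, hu, hau⟩ := List.mem_flatten.1 ha
  exact ⟨u, hl u hu, hau⟩

lemma LetterMask.star {L : Language (Fin σ)} {x : ℕ} (hx : LetterMask τ L x) :
    LetterMask τ L∗ (x ||| 2 ^ τ) where
  lt := Nat.or_lt_two_pow hx.lt (Nat.pow_lt_pow_right (by simp) (by omega))
  nonempty := by
    rw [Nat.testBit_or, Nat.testBit_two_pow_self, Bool.or_true]
    exact iff_of_true rfl ⟨[], nil_mem_kstar L⟩
  letters i hi := by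
    have : τ ≠ i := by omega
    rw [Nat.testBit_or, Nat.testBit_two_pow, decide_eq_false this, Bool.or_false,
      hx.letters i hi]
    constructor
    · rintro ⟨v, hv, h⟩
      exact ⟨v, mem_kstar_of_mem hv, h⟩
    · rintro ⟨v, hv, a, ha, h⟩
      obtain ⟨u, hu, hau⟩ := exists_mem_of_mem_kstar hv ha
      exact ⟨u, hu, a, hau, h⟩

lemma LetterMask.testBit_and {L : Language (Fin σ)} {x : ℕ} (hστ : σ ≤ τ)
    (hx : LetterMask τ L x) (i : ℕ) :
    (x &&& (2 ^ τ - 1)).testBit i = true ↔ ∃ v ∈ L, ∃ a ∈ v, a.val = i := by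
  rw [Nat.testBit_and, Nat.testBit_two_pow_sub_one, Bool.and_eq_true, decide_eq_true_eq]
  constructor
  · rintro ⟨h, hi⟩
    exact (hx.letters i hi).1 h
  · rintro ⟨v, hv, a, ha, rfl⟩
    have : a.val < τ := by omega
    exact ⟨(hx.letters _ this).2 ⟨v, hv, a, ha, rfl⟩, this⟩

lemma LetterMask.wordMask_or {L : Language (Fin σ)} {x : ℕ} (hστ : σ ≤ τ)
    (hx : LetterMask τ L x) {v : List (Fin σ)} (hv : v ∈ L∗) :
    wordMask v ||| (x &&& (2 ^ τ - 1)) = x &&& (2 ^ τ - 1) := by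
  rw [or_eq_right_iff]
  intro i hi
  rw [hx.testBit_and hστ]
  obtain ⟨a, ha, rfl⟩ := (testBit_wordMask v i).1 hi
  obtain ⟨u, hu, hau⟩ := exists_mem_of_mem_kstar hv ha
  exact ⟨u, hu, a, hau, rfl⟩

/-- For every letter that occurs in `L`, append a word of `L` containing it; the star contains this
single word with all letters. -/
lemma LetterMask.exists_wordMask_eq {L : Language (Fin σ)} {x : ℕ} (hστ : σ ≤ τ)
    (hx : LetterMask τ L x) : ∃ v ∈ L∗, wordMask v = x &&& (2 ^ τ - 1) := by
  have key : ∀ j, ∃ v ∈ L∗, ∀ i < j, (x &&& (2 ^ τ - 1)).testBit i = true →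
      (wordMask v).testBit i = true := by
    intro j
    induction j with
    | zero => exact ⟨[], nil_mem_kstar L, by simp⟩
    | succ j ih =>
      obtain ⟨v, hv, h⟩ := ih
      by_cases hj : (x &&& (2 ^ τ - 1)).testBit j = true
      · obtain ⟨u, hu, hju⟩ := (hx.testBit_and hστ j).1 hj
        refine ⟨u ++ v, append_mem_kstar (mem_kstar_of_mem hu) hv, ?_⟩
        intro i hi hbit
        rw [wordMask_append, Nat.testBit_or, Bool.or_eq_true]
        by_cases hij : i = j
        · left
          rw [hij]
          exact (testBit_wordMask u j).2 hju
        · exact Or.inr (h i (by omega) hbit)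
      · refine ⟨v, hv, fun i hi hbit => ?_⟩
        by_cases hij : i = j
        · exact absurd (hij ▸ hbit) hj
        · exact h i (by omega) hbit
  obtain ⟨v, hv, h⟩ := key τ
  refine ⟨v, hv, ?_⟩
  rw [← hx.wordMask_or hστ hv, Nat.or_comm, eq_comm, or_eq_right_iff]
  intro i hi
  refine h i ?_ hi
  rw [Nat.testBit_and, Nat.testBit_two_pow_sub_one] at hi
  simp at hi
  exact hi.2

end

end KUniversality

namespace WordRAM

section

/-! ### Structured programs -/

/-- Registers and memory. -/
structure Store where
  reg : ℕ → ℕ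
  mem : ℕ → ℕ

/-- Structured programs for the word RAM. -/
inductive Cmd where
  | skip
  | const (d c : ℕ)
  | op (o : BinOp) (d a b : ℕ)
  | load (d a : ℕ)
  | store (a b : ℕ)
  | seq (c₁ c₂ : Cmd)
  | ifEq (a b : ℕ) (c₁ c₂ : Cmd)
  | ifLt (a b : ℕ) (c₁ c₂ : Cmd)
  | whileLt (a b : ℕ) (c : Cmd)

infixr:60 " ;; " => Cmd.seq

/-- `Exec w c s t s'`: started in `s`, the program `c` ends in `s'` after `t` steps. -/
inductive Exec (w : ℕ) : Cmd → Store → ℕ → Store → Prop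
  | skip (s) : Exec w .skip s 0 s
  | const (d c s) : Exec w (.const d c) s 1 ⟨Function.update s.reg d (c % 2 ^ w), s.mem⟩
  | op (o d a b s) :
      Exec w (.op o d a b) s 1 ⟨Function.update s.reg d (o.eval w (s.reg a) (s.reg b)), s.mem⟩
  | load (d a s) : Exec w (.load d a) s 1 ⟨Function.update s.reg d (s.mem (s.reg a)), s.mem⟩
  | store (a b s) : Exec w (.store a b) s 1 ⟨s.reg, Function.update s.mem (s.reg a) (s.reg b)⟩
  | seq {c₁ c₂ s s₁ s₂ t₁ t₂} : Exec w c₁ s t₁ s₁ → Exec w c₂ s₁ t₂ s₂ →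
      Exec w (.seq c₁ c₂) s (t₁ + t₂) s₂
  | ifEq_pos {a b c₁ c₂ s t s'} : s.reg a = s.reg b → Exec w c₁ s t s' →
      Exec w (.ifEq a b c₁ c₂) s (1 + t) s'
  | ifEq_neg {a b c₁ c₂ s t s'} : s.reg a ≠ s.reg b → Exec w c₂ s t s' →
      Exec w (.ifEq a b c₁ c₂) s (1 + t + 1) s'
  | ifLt_pos {a b c₁ c₂ s t s'} : s.reg a < s.reg b → Exec w c₁ s t s' →
      Exec w (.ifLt a b c₁ c₂) s (1 + t) s'
  | ifLt_neg {a b c₁ c₂ s t s'} : ¬ s.reg a < s.reg b → Exec w c₂ s t s' →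
      Exec w (.ifLt a b c₁ c₂) s (1 + t + 1) s'
  | whileLt_done {a b c s} : ¬ s.reg a < s.reg b → Exec w (.whileLt a b c) s 2 s
  | whileLt_step {a b c s t₁ s₁ t₂ s₂} : s.reg a < s.reg b → Exec w c s t₁ s₁ →
      Exec w (.whileLt a b c) s₁ t₂ s₂ → Exec w (.whileLt a b c) s (1 + t₁ + 1 + t₂) s₂

/-- The number of instructions of a compiled program. -/
def Cmd.size : Cmd → ℕ
  | .skip => 0
  | .const _ _ => 1
  | .op _ _ _ _ => 1
  | .load _ _ => 1
  | .store _ _ => 1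
  | .seq c₁ c₂ => c₁.size + c₂.size
  | .ifEq _ _ c₁ c₂ => 1 + c₂.size + 1 + c₁.size
  | .ifLt _ _ c₁ c₂ => 1 + c₂.size + 1 + c₁.size
  | .whileLt _ _ c => 2 + c.size + 1

/-- The instructions of a program that is placed at the address `l`. -/
def Cmd.compile : Cmd → ℕ → List Instr
  | .skip, _ => []
  | .const d c, _ => [.const d c]
  | .op o d a b, _ => [.op o d a b]
  | .load d a, _ => [.load d a]
  | .store a b, _ => [.store a b]
  | .seq c₁ c₂, l => c₁.compile l ++ c₂.compile (l + c₁.size)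
  | .ifEq a b c₁ c₂, l =>
    -- The test jumps when it succeeds, so the else branch comes first. It ends with the
    -- unconditional jump `jumpEq 0 0`, which accounts for the extra step in `Exec.ifEq_neg`.
    [.jumpEq a b (l + 1 + c₂.size + 1)] ++ c₂.compile (l + 1) ++
      [.jumpEq 0 0 (l + 1 + c₂.size + 1 + c₁.size)] ++ c₁.compile (l + 1 + c₂.size + 1)
  | .ifLt a b c₁ c₂, l =>
    [.jumpLt a b (l + 1 + c₂.size + 1)] ++ c₂.compile (l + 1) ++
      [.jumpEq 0 0 (l + 1 + c₂.size + 1 + c₁.size)] ++ c₁.compile (l + 1 + c₂.size + 1)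
  | .whileLt a b c, l =>
    [.jumpLt a b (l + 2), .jumpEq 0 0 (l + 2 + c.size + 1)] ++ c.compile (l + 2) ++
      [.jumpEq 0 0 l]

lemma Cmd.length_compile (c : Cmd) (l : ℕ) : (c.compile l).length = c.size := by
  induction c generalizing l <;> simp [Cmd.compile, Cmd.size, *] <;> omega

/-- The list `code` is found in the program `P` from the address `l` on. -/
def CodeAt (P : List Instr) (l : ℕ) (code : List Instr) : Prop := code <+: P.drop l

lemma CodeAt.append {P : List Instr} {l : ℕ} {c₁ c₂ : List Instr} (h : CodeAt P l (c₁ ++ c₂)) :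
    CodeAt P l c₁ ∧ CodeAt P (l + c₁.length) c₂ := by
  obtain ⟨r, hr⟩ := h
  refine ⟨⟨c₂ ++ r, by rw [← hr, List.append_assoc]⟩, ⟨r, ?_⟩⟩
  rw [← List.drop_drop, ← hr, List.append_assoc, List.drop_left]

lemma CodeAt.getElem? {P : List Instr} {l : ℕ} {i : Instr} {c : List Instr}
    (h : CodeAt P l (i :: c)) : P[l]? = some i := by
  obtain ⟨r, hr⟩ := h
  have : (P.drop l)[0]? = some i := by rw [← hr]; rfl
  simpa using this

lemma step_of_codeAt {w : ℕ} {P : List Instr} {s : State} {i : Instr} {c : List Instr}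
    (h : CodeAt P s.pc (i :: c)) : step w P s = i.exec w s := by
  rw [step, h.getElem?]

lemma iterate_step_trans {w t u : ℕ} {P : List Instr} {s s₁ s₂ : State}
    (h₁ : (step w P)^[t] s = s₁) (h₂ : (step w P)^[u] s₁ = s₂) :
    (step w P)^[t + u] s = s₂ := by
  rw [Nat.add_comm, Function.iterate_add_apply, h₁, h₂]

/-- Induction over the execution and not over the command: the remaining rounds of a loop run the
same code at the same address. -/
theorem Exec.compile {w : ℕ} {P : List Instr} {c : Cmd} {s s' : Store} {t : ℕ}
    (h : Exec w c s t s') : ∀ l, CodeAt P l (c.compile l) →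
      (step w P)^[t] ⟨l, s.reg, s.mem⟩ = ⟨l + c.size, s'.reg, s'.mem⟩ := by
  have goto : ∀ {l l' : ℕ} {c : List Instr} (s : Store), CodeAt P l (.jumpEq 0 0 l' :: c) →
      (step w P)^[1] ⟨l, s.reg, s.mem⟩ = ⟨l', s.reg, s.mem⟩ := by
    intro l l' c s h
    rw [Function.iterate_one, step_of_codeAt (by exact h)]
    simp [Instr.exec]
  induction h with
  | skip s => intro l _; rfl
  | const d c s =>
    intro l h
    rw [Function.iterate_one, step_of_codeAt (by exact h)]
    rfl
  | op o d a b s =>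
    intro l h
    rw [Function.iterate_one, step_of_codeAt (by exact h)]
    rfl
  | load d a s =>
    intro l h
    rw [Function.iterate_one, step_of_codeAt (by exact h)]
    rfl
  | store a b s =>
    intro l h
    rw [Function.iterate_one, step_of_codeAt (by exact h)]
    rfl
  | seq _ _ ih₁ ih₂ =>
    intro l h
    obtain ⟨h₁, h₂⟩ := h.append
    rw [Cmd.length_compile] at h₂
    rw [Cmd.size, ← Nat.add_assoc]
    exact iterate_step_trans (ih₁ l h₁) (ih₂ _ h₂)
  | @ifEq_pos a b c₁ c₂ s t s' hab _ ih =>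
    intro l h
    have hj : (step w P)^[1] ⟨l, s.reg, s.mem⟩ = ⟨l + 1 + c₂.size + 1, s.reg, s.mem⟩ := by
      rw [Function.iterate_one, step_of_codeAt (by exact h)]
      simp [Instr.exec, hab]
    have h₁ := h.append.2
    simp only [List.length_append, Cmd.length_compile, List.length_singleton,
      ← Nat.add_assoc] at h₁
    have := iterate_step_trans hj (ih _ h₁)
    rw [this, Cmd.size]
    simp only [← Nat.add_assoc]
  | @ifEq_neg a b c₁ c₂ s t s' hab _ ih =>
    intro l h
    have hj : (step w P)^[1] ⟨l, s.reg, s.mem⟩ = ⟨l + 1, s.reg, s.mem⟩ := by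
      rw [Function.iterate_one, step_of_codeAt (by exact h)]
      simp [Instr.exec, hab]
    have h₂ := h.append.1.append.1.append.2
    have h₃ := h.append.1.append.2
    simp only [List.length_append, Cmd.length_compile, List.length_singleton,
      ← Nat.add_assoc] at h₂ h₃
    have := iterate_step_trans (iterate_step_trans hj (ih _ h₂)) (goto s' h₃)
    rw [this, Cmd.size]
    simp only [← Nat.add_assoc]
  | @ifLt_pos a b c₁ c₂ s t s' hab _ ih =>
    intro l h
    have hj : (step w P)^[1] ⟨l, s.reg, s.mem⟩ = ⟨l + 1 + c₂.size + 1, s.reg, s.mem⟩ := by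
      rw [Function.iterate_one, step_of_codeAt (by exact h)]
      simp [Instr.exec, hab]
    have h₁ := h.append.2
    simp only [List.length_append, Cmd.length_compile, List.length_singleton,
      ← Nat.add_assoc] at h₁
    have := iterate_step_trans hj (ih _ h₁)
    rw [this, Cmd.size]
    simp only [← Nat.add_assoc]
  | @ifLt_neg a b c₁ c₂ s t s' hab _ ih =>
    intro l h
    have hj : (step w P)^[1] ⟨l, s.reg, s.mem⟩ = ⟨l + 1, s.reg, s.mem⟩ := by
      rw [Function.iterate_one, step_of_codeAt (by exact h)]
      simp [Instr.exec, hab]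
    have h₂ := h.append.1.append.1.append.2
    have h₃ := h.append.1.append.2
    simp only [List.length_append, Cmd.length_compile, List.length_singleton,
      ← Nat.add_assoc] at h₂ h₃
    have := iterate_step_trans (iterate_step_trans hj (ih _ h₂)) (goto s' h₃)
    rw [this, Cmd.size]
    simp only [← Nat.add_assoc]
  | @whileLt_done a b c s hab =>
    intro l h
    have hj : (step w P)^[1] ⟨l, s.reg, s.mem⟩ = ⟨l + 1, s.reg, s.mem⟩ := by
      rw [Function.iterate_one, step_of_codeAt (by exact h)]
      simp [Instr.exec, hab]
    have h₁ : CodeAt P (l + 1) (.jumpEq 0 0 (l + 2 + c.size + 1) :: _) :=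
      (CodeAt.append (c₁ := [.jumpLt a b (l + 2)]) h).2
    have := iterate_step_trans hj (goto s h₁)
    rw [this, Cmd.size]
    simp only [← Nat.add_assoc]
  | @whileLt_step a b c s t₁ s₁ t₂ s₂ hab _ _ ih₁ ih₂ =>
    intro l h
    have hj : (step w P)^[1] ⟨l, s.reg, s.mem⟩ = ⟨l + 2, s.reg, s.mem⟩ := by
      rw [Function.iterate_one, step_of_codeAt (by exact h)]
      simp [Instr.exec, hab]
    have h₁ := h.append.1.append.2
    have h₂ := h.append.2
    simp only [List.length_append, Cmd.length_compile, List.length_cons, List.length_nil,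
      ← Nat.add_assoc] at h₁ h₂
    exact iterate_step_trans (iterate_step_trans (iterate_step_trans hj (ih₁ _ h₁))
      (goto s₁ h₂)) (ih₂ l h)

/-! ### Weakest preconditions with time -/

/-- Started in `s` at time `t`, the program `c` ends in a store and at a time which satisfy
`Q`. -/
def Wp (w : ℕ) (c : Cmd) (Q : ℕ → Store → Prop) (t : ℕ) (s : Store) : Prop :=
  ∃ m s', Exec w c s m s' ∧ Q (t + m) s'

variable {w : ℕ} {Q : ℕ → Store → Prop} {t : ℕ} {s : Store}

lemma Wp.skip (h : Q t s) : Wp w .skip Q t s := ⟨_, _, .skip s, h⟩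

lemma Wp.const {d c : ℕ} (h : Q (t + 1) ⟨Function.update s.reg d (c % 2 ^ w), s.mem⟩) :
    Wp w (.const d c) Q t s := ⟨_, _, .const d c s, h⟩

lemma Wp.op {o : BinOp} {d a b : ℕ}
    (h : Q (t + 1) ⟨Function.update s.reg d (o.eval w (s.reg a) (s.reg b)), s.mem⟩) :
    Wp w (.op o d a b) Q t s := ⟨_, _, .op o d a b s, h⟩

lemma Wp.load {d a : ℕ} (h : Q (t + 1) ⟨Function.update s.reg d (s.mem (s.reg a)), s.mem⟩) :
    Wp w (.load d a) Q t s := ⟨_, _, .load d a s, h⟩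

lemma Wp.store {a b : ℕ} (h : Q (t + 1) ⟨s.reg, Function.update s.mem (s.reg a) (s.reg b)⟩) :
    Wp w (.store a b) Q t s := ⟨_, _, .store a b s, h⟩

lemma Wp.seq {c₁ c₂ : Cmd} (h : Wp w c₁ (Wp w c₂ Q) t s) : Wp w (c₁ ;; c₂) Q t s := by
  obtain ⟨m₁, s₁, h₁, m₂, s₂, h₂, hQ⟩ := h
  exact ⟨_, _, .seq h₁ h₂, by rwa [← Nat.add_assoc]⟩

lemma Wp.ifEq {a b : ℕ} {c₁ c₂ : Cmd} (h₁ : s.reg a = s.reg b → Wp w c₁ Q (t + 1) s)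
    (h₂ : s.reg a ≠ s.reg b → Wp w c₂ (fun t' => Q (t' + 1)) (t + 1) s) :
    Wp w (.ifEq a b c₁ c₂) Q t s := by
  by_cases h : s.reg a = s.reg b
  · obtain ⟨m, s', he, hQ⟩ := h₁ h
    exact ⟨_, _, .ifEq_pos h he, by rwa [← Nat.add_assoc]⟩
  · obtain ⟨m, s', he, hQ⟩ := h₂ h
    exact ⟨_, _, .ifEq_neg h he, by simpa only [← Nat.add_assoc] using hQ⟩

lemma Wp.ifLt {a b : ℕ} {c₁ c₂ : Cmd} (h₁ : s.reg a < s.reg b → Wp w c₁ Q (t + 1) s)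
    (h₂ : ¬ s.reg a < s.reg b → Wp w c₂ (fun t' => Q (t' + 1)) (t + 1) s) :
    Wp w (.ifLt a b c₁ c₂) Q t s := by
  by_cases h : s.reg a < s.reg b
  · obtain ⟨m, s', he, hQ⟩ := h₁ h
    exact ⟨_, _, .ifLt_pos h he, by rwa [← Nat.add_assoc]⟩
  · obtain ⟨m, s', he, hQ⟩ := h₂ h
    exact ⟨_, _, .ifLt_neg h he, by simpa only [← Nat.add_assoc] using hQ⟩

lemma Wp.whileLt_done {a b : ℕ} {c : Cmd} (h : ¬ s.reg a < s.reg b) (hQ : Q (t + 2) s) :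
    Wp w (.whileLt a b c) Q t s := ⟨_, _, .whileLt_done h, hQ⟩

lemma Wp.whileLt_step {a b : ℕ} {c : Cmd} (h : s.reg a < s.reg b)
    (hc : Wp w c (fun t' => Wp w (.whileLt a b c) Q (t' + 1)) (t + 1) s) :
    Wp w (.whileLt a b c) Q t s := by
  obtain ⟨m, s', he, m', s'', he', hQ⟩ := hc
  exact ⟨_, _, .whileLt_step h he he', by simpa only [← Nat.add_assoc] using hQ⟩

lemma Wp.mono {c : Cmd} {Q' : ℕ → Store → Prop} (h : Wp w c Q t s)
    (hQ : ∀ t' s', Q t' s' → Q' t' s') : Wp w c Q' t s := by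
  obtain ⟨m, s', he, h'⟩ := h
  exact ⟨m, s', he, hQ _ _ h'⟩

/-- A loop that is executed `N` times. -/
lemma Wp.for_loop {a b : ℕ} {c : Cmd} (I : ℕ → Store → Prop) (N B : ℕ) (h0 : I 0 s)
    (hcond : ∀ j s, I j s → (s.reg a < s.reg b ↔ j < N))
    (hstep : ∀ j < N, ∀ s t, I j s → Wp w c (fun t' s' => t' ≤ t + B ∧ I (j + 1) s') t s)
    (hQ : ∀ t' s', t' ≤ t + N * (B + 2) + 2 → I N s' → Q t' s') :
    Wp w (.whileLt a b c) Q t s := by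
  have key : ∀ m j, j + m = N → ∀ s t', I j s → t' ≤ t + j * (B + 2) →
      Wp w (.whileLt a b c) Q t' s := by
    intro m
    induction m with
    | zero =>
      intro j hj s t' hI ht'
      have hj' : j = N := by omega
      subst hj'
      exact Wp.whileLt_done (by rw [hcond j s hI]; omega) (hQ _ _ (by omega) hI)
    | succ m ih =>
      intro j hj s t' hI ht'
      refine Wp.whileLt_step ((hcond j s hI).2 (by omega)) ?_
      refine (hstep j (by omega) s (t' + 1) hI).mono ?_
      rintro t'' s'' ⟨ht'', hI'⟩
      refine ih (j + 1) (by omega) s'' _ hI' ?_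
      rw [Nat.add_mul]
      omega
  exact key N 0 (by omega) s t h0 (by omega)

end

/-! ### Counted loops -/

section

variable {w : ℕ} {Q : ℕ → Store → Prop} {t : ℕ} {s : Store}

/-- Execute `c` for the values `0, 1, …` of register `20` that are less than register `r`. -/
def Cmd.forLt (r : ℕ) (c : Cmd) : Cmd :=
  .const 20 0 ;; .whileLt 20 r (c ;; .op .add 20 20 7)

/-- The invariant `J` speaks of the memory only; the registers below `20` must be preserved, those
above `20` are scratch. Beyond the `B` steps of the body, a round costs the increment, the test and
the jump back. The final `3` pays for the initialisation, the failing test and the exit jump. -/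
lemma Wp.forLt {r : ℕ} {c : Cmd} (J : ℕ → (ℕ → ℕ) → Prop) (N B : ℕ) (hr : r < 20)
    (hN : s.reg r = N) (h7 : s.reg 7 = 1) (hNw : N < 2 ^ w) (h0 : J 0 s.mem)
    (hstep : ∀ j < N, ∀ s' t', (∀ i < 20, s'.reg i = s.reg i) → s'.reg 20 = j → J j s'.mem →
      Wp w c (fun t'' s'' => t'' ≤ t' + B ∧ (∀ i < 20, s''.reg i = s.reg i) ∧ s''.reg 20 = j ∧
        J (j + 1) s''.mem) t' s')
    (hQ : ∀ t' s', t' ≤ t + N * (B + 3) + 3 → (∀ i < 20, s'.reg i = s.reg i) → J N s'.mem →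
      Q t' s') : Wp w (Cmd.forLt r c) Q t s := by
  refine Wp.seq (Wp.const ?_)
  refine Wp.for_loop
    (fun j s' => (∀ i < 20, s'.reg i = s.reg i) ∧ s'.reg 20 = j ∧ J j s'.mem) N (B + 1)
    ⟨?_, ?_, h0⟩ ?_ ?_ ?_
  · intro i hi
    exact Function.update_of_ne (by omega) _ _
  · simp
  · rintro j s' ⟨h1, h2, -⟩
    rw [h2, h1 r hr, hN]
  · rintro j hj s' t' ⟨h1, h2, h3⟩
    refine Wp.seq ((hstep j hj s' t' h1 h2 h3).mono ?_)
    rintro t'' s'' ⟨ht, h1', h2', h3'⟩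
    refine Wp.op ⟨by omega, ?_, ?_, h3'⟩
    · intro i hi
      rw [← h1' i hi]
      exact Function.update_of_ne (by omega) _ _
    · simp only [Function.update_self, BinOp.eval]
      rw [h2', h1' 7 (by omega), h7, Nat.mod_eq_of_lt (by omega)]
  · rintro t' s' ht ⟨h1, -, h3⟩
    rw [show B + 1 + 2 = B + 3 from rfl] at ht
    exact hQ t' s' (by omega) h1 h3

end

end WordRAM

namespace KUniversality

/-! ### Passes over a table -/

section

open WordRAM

variable {w : ℕ} {Q : ℕ → Store → Prop} {t : ℕ} {s : Store} {N b p : ℕ}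

/-- Clear the entries of the array at register `11`. -/
def clearLoop : Cmd := .forLt 9 (.op .add 21 11 20 ;; .store 21 8)

/-- Copy the table at register `11` to register `12`. -/
def copyLoop : Cmd :=
  .forLt 3 (.op .add 21 11 20 ;; .load 22 21 ;; .op .add 21 12 20 ;; .store 21 22)

/-- Exchange the tables at the registers `11` and `12`. -/
def swapLoop : Cmd :=
  .forLt 3 (.op .add 21 11 20 ;; .load 22 21 ;; .op .add 23 12 20 ;; .load 24 23 ;;
    .store 21 24 ;; .store 23 22)

/-- Replace the table at register `12` by its maximum with the table at register `11`. -/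
def maxLoop : Cmd :=
  .forLt 3 (.op .add 21 11 20 ;; .load 22 21 ;; .op .add 23 12 20 ;; .load 24 23 ;;
    .ifLt 24 22 (.store 23 22) .skip)

/-- Add the letters in register `13` to all states of the table at register `12`. -/
def orLoop : Cmd :=
  .forLt 3 (.op .or 21 20 13 ;; .ifEq 21 20 .skip
    (.op .add 22 12 20 ;; .load 23 22 ;; .op .add 24 12 21 ;; .load 25 24 ;;
      .ifLt 25 23 (.store 24 23) .skip ;; .store 22 8))

lemma clearLoop_spec (hN : s.reg 9 = N) (h7 : s.reg 7 = 1) (h8 : s.reg 8 = 0)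
    (hb : s.reg 11 = b) (hNw : N < 2 ^ w) (hbN : b + N ≤ 2 ^ w)
    (hQ : ∀ t' s', t' ≤ t + N * 5 + 3 → (∀ i < 20, s'.reg i = s.reg i) →
      (∀ S < N, s'.mem (b + S) = 0) → (∀ a, a < b ∨ b + N ≤ a → s'.mem a = s.mem a) → Q t' s') :
    Wp w clearLoop Q t s := by
  refine Wp.forLt (fun j m => (∀ S < j, m (b + S) = 0) ∧ ∀ a, a < b ∨ b + N ≤ a → m a = s.mem a)
    N 2 (by norm_num) hN h7 hNw ⟨by omega, fun _ _ => rfl⟩ ?_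
    (fun t' s' ht hr hJ => hQ t' s' ht hr hJ.1 hJ.2)
  rintro j hj s' t' hr h20 ⟨hJ, hJ'⟩
  have h8' := (hr 8 (by norm_num)).trans h8
  have hb' := (hr 11 (by norm_num)).trans hb
  refine Wp.seq (Wp.op (Wp.store ⟨by omega, ?_, ?_, ?_⟩))
  · intro i hi
    rw [← hr i hi]
    exact Function.update_of_ne (by omega) _ _
  · simpa using h20
  · simp [BinOp.eval, h8', hb', h20]
    rw [Nat.mod_eq_of_lt (by omega)]
    constructor
    · intro S hS
      rw [Function.update_apply]
      grind
    · intro a ha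
      rw [Function.update_apply]
      grind

lemma copyLoop_spec (hN : s.reg 3 = N) (h7 : s.reg 7 = 1)
    (hb : s.reg 11 = b) (hp : s.reg 12 = p) (hbp : b + N ≤ p) (hpN : p + N < 2 ^ w)
    (hQ : ∀ t' s', t' ≤ t + N * 7 + 3 → (∀ i < 20, s'.reg i = s.reg i) →
      (∀ S < N, s'.mem (p + S) = s.mem (b + S)) →
      (∀ a, a < p ∨ p + N ≤ a → s'.mem a = s.mem a) → Q t' s') :
    Wp w copyLoop Q t s := by
  refine Wp.forLt (fun j m => (∀ S < j, m (p + S) = s.mem (b + S)) ∧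
    ∀ a, a < p ∨ p + N ≤ a → m a = s.mem a)
    N 4 (by norm_num) hN h7 (by omega) ⟨by omega, fun _ _ => rfl⟩ ?_
    (fun t' s' ht hr hJ => hQ t' s' ht hr hJ.1 hJ.2)
  rintro j hj s' t' hr h20 ⟨hJ, hJ'⟩
  have hb' := (hr 11 (by norm_num)).trans hb
  have hp' := (hr 12 (by norm_num)).trans hp
  have e1 : (b + j) % 2 ^ w = b + j := Nat.mod_eq_of_lt (by omega)
  have e2 : (p + j) % 2 ^ w = p + j := Nat.mod_eq_of_lt (by omega)
  refine Wp.seq (Wp.op (Wp.seq (Wp.load (Wp.seq (Wp.op (Wp.store ⟨by omega, ?_, ?_, ?_⟩))))))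
  · intro i hi
    rw [← hr i hi]
    simp (disch := omega) only [Function.update_of_ne]
  · simpa using h20
  · simp [BinOp.eval, hp', hb', h20, e1, e2]
    constructor
    · intro S hS
      rw [Function.update_apply]
      grind
    · intro a ha
      rw [Function.update_apply]
      grind

lemma swapLoop_spec (hN : s.reg 3 = N) (h7 : s.reg 7 = 1)
    (hb : s.reg 11 = b) (hp : s.reg 12 = p) (hbp : p + N ≤ b) (hpN : b + N < 2 ^ w)
    (hQ : ∀ t' s', t' ≤ t + N * 9 + 3 → (∀ i < 20, s'.reg i = s.reg i) →
      (∀ S < N, s'.mem (p + S) = s.mem (b + S)) →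
      (∀ S < N, s'.mem (b + S) = s.mem (p + S)) →
      (∀ a, a < p ∨ p + N ≤ a → a < b ∨ b + N ≤ a → s'.mem a = s.mem a) → Q t' s') :
    Wp w swapLoop Q t s := by
  refine Wp.forLt (fun j m => (∀ S < j, m (p + S) = s.mem (b + S)) ∧
    (∀ S < j, m (b + S) = s.mem (p + S)) ∧
    ∀ a, a < p ∨ p + j ≤ a → a < b ∨ b + j ≤ a → m a = s.mem a)
    N 6 (by norm_num) hN h7 (by omega) ⟨by omega, by omega, fun _ _ _ => rfl⟩ ?_
    (fun t' s' ht hr hJ => hQ t' s' ht hr hJ.1 hJ.2.1 hJ.2.2)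
  rintro j hj s' t' hr h20 ⟨hJ, hJ', hJ''⟩
  have hb' := (hr 11 (by norm_num)).trans hb
  have hp' := (hr 12 (by norm_num)).trans hp
  have e1 : (b + j) % 2 ^ w = b + j := Nat.mod_eq_of_lt (by omega)
  have e2 : (p + j) % 2 ^ w = p + j := Nat.mod_eq_of_lt (by omega)
  refine Wp.seq (Wp.op (Wp.seq (Wp.load (Wp.seq (Wp.op (Wp.seq (Wp.load (Wp.seq (Wp.store
    (Wp.store ⟨by omega, ?_, ?_, ?_⟩))))))))))
  · intro i hi
    rw [← hr i hi]
    simp (disch := omega) only [Function.update_of_ne]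
  · simpa using h20
  · simp [BinOp.eval, hp', hb', h20, e1, e2]
    simp only [Function.update_apply]
    refine ⟨?_, ?_, ?_⟩ <;> grind

lemma maxLoop_spec (hN : s.reg 3 = N) (h7 : s.reg 7 = 1)
    (hb : s.reg 11 = b) (hp : s.reg 12 = p) (hbp : p + N ≤ b) (hpN : b + N < 2 ^ w)
    (hQ : ∀ t' s', t' ≤ t + N * 10 + 3 → (∀ i < 20, s'.reg i = s.reg i) →
      (∀ S < N, s'.mem (p + S) = max (s.mem (p + S)) (s.mem (b + S))) →
      (∀ a, a < p ∨ p + N ≤ a → s'.mem a = s.mem a) → Q t' s') :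
    Wp w maxLoop Q t s := by
  refine Wp.forLt (fun j m => (∀ S < j, m (p + S) = max (s.mem (p + S)) (s.mem (b + S))) ∧
    ∀ a, a < p ∨ p + j ≤ a → m a = s.mem a)
    N 7 (by norm_num) hN h7 (by omega) ⟨by omega, fun _ _ => rfl⟩ ?_
    (fun t' s' ht hr hJ => hQ t' s' ht hr hJ.1 hJ.2)
  rintro j hj s' t' hr h20 ⟨hJ, hJ'⟩
  have hb' := (hr 11 (by norm_num)).trans hb
  have hp' := (hr 12 (by norm_num)).trans hp
  have e1 : (b + j) % 2 ^ w = b + j := Nat.mod_eq_of_lt (by omega)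
  have e2 : (p + j) % 2 ^ w = p + j := Nat.mod_eq_of_lt (by omega)
  refine Wp.seq (Wp.op (Wp.seq (Wp.load (Wp.seq (Wp.op (Wp.seq (Wp.load
    (Wp.ifLt (fun h => Wp.store ⟨by omega, ?_, ?_, ?_⟩)
      (fun h => Wp.skip ⟨by omega, ?_, ?_, ?_⟩)))))))))
  · intro i hi
    rw [← hr i hi]
    simp (disch := omega) only [Function.update_of_ne]
  · simpa using h20
  · simp [BinOp.eval, hp', hb', h20, e1, e2] at h ⊢
    simp only [Function.update_apply]
    refine ⟨?_, ?_⟩ <;> grind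
  · intro i hi
    rw [← hr i hi]
    simp (disch := omega) only [Function.update_of_ne]
  · simpa using h20
  · simp [BinOp.eval, hp', hb', h20, e1, e2] at h ⊢
    refine ⟨?_, ?_⟩ <;> grind

/-- Complete the arch of the states with all letters in the table at register `12`, with the
remainder in register `14`. -/
def completeArch : Cmd :=
  .op .add 21 12 6 ;; .load 22 21 ;; .ifEq 22 8 .skip
    (.ifLt 22 5 (.op .add 22 22 7) .skip ;; .store 21 8 ;; .op .add 23 12 14 ;; .load 24 23 ;;
      .ifLt 24 22 (.store 23 22) .skip)

/-- `E` arises from `D` by adding the letters in `A` to the states with a mask less than `j`. -/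
structure AddsLettersUpTo (τ A j : ℕ) (D E : ℕ → ℕ) : Prop where
  le_of_lt : ∀ S < 2 ^ τ, S < j → D S ≤ E (S ||| A)
  le_of_ge : ∀ S < 2 ^ τ, j ≤ S → D S ≤ E S
  exists_eq : ∀ T < 2 ^ τ, E T ≠ 0 →
    ∃ S < 2 ^ τ, D S = E T ∧ (S ||| A = T ∨ (S = T ∧ j ≤ T))

lemma AddsLettersUpTo.zero (τ A : ℕ) (D : ℕ → ℕ) : AddsLettersUpTo τ A 0 D D where
  le_of_lt S _ h := absurd h (by omega)
  le_of_ge S _ _ := le_rfl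
  exists_eq T hT _ := ⟨T, hT, rfl, Or.inr ⟨rfl, by omega⟩⟩

lemma AddsLettersUpTo.addsLetters {τ A : ℕ} {D E : ℕ → ℕ}
    (h : AddsLettersUpTo τ A (2 ^ τ) D E) : AddsLetters τ A D E where
  le S hS := h.le_of_lt S hS hS
  exists_eq T hT hne := by
    obtain ⟨S, hS, h1, h2⟩ := h.exists_eq T hT hne
    exact ⟨S, hS, by omega, h1⟩

lemma AddsLettersUpTo.succ_of_eq {τ A j : ℕ} {D E : ℕ → ℕ} (h : AddsLettersUpTo τ A j D E)
    (hj : j ||| A = j) : AddsLettersUpTo τ A (j + 1) D E where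
  le_of_lt S hS hSj := by
    by_cases hSj' : S = j
    · subst hSj'
      rw [hj]
      exact h.le_of_ge S hS le_rfl
    · exact h.le_of_lt S hS (by omega)
  le_of_ge S hS hSj := h.le_of_ge S hS (by omega)
  exists_eq T hT hne := by
    obtain ⟨S, hS, h1, h2⟩ := h.exists_eq T hT hne
    refine ⟨S, hS, h1, ?_⟩
    rcases h2 with h2 | ⟨h2, h3⟩
    · exact Or.inl h2
    · by_cases hjT : j = T
      · left
        rw [h2, ← hjT, hj]
      · exact Or.inr ⟨h2, by omega⟩

/-- Why the update can be done in place. An entry is moved upwards to `j ||| A`, a set that adding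
`A` fixes, so it is never moved again. A set `j` that lacks letters of `A` is not a target, so
clearing its entry loses nothing that was moved before. -/
lemma AddsLettersUpTo.succ {τ A j : ℕ} {D E E' : ℕ → ℕ} (h : AddsLettersUpTo τ A j D E)
    (hjτ : j < 2 ^ τ) (hj : j ||| A ≠ j) (hE : E' (j ||| A) = max (E j) (E (j ||| A)))
    (hEj : E' j = 0) (hEo : ∀ S, S ≠ j → S ≠ j ||| A → E' S = E S) :
    AddsLettersUpTo τ A (j + 1) D E' := by
  have hle : j ≤ j ||| A := Nat.left_le_or
  have hmono : ∀ S, S ≠ j → E S ≤ E' S := by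
    intro S hS
    by_cases hS' : S = j ||| A
    · rw [hS', hE]
      exact le_max_right _ _
    · rw [hEo S hS hS']
  have hne : ∀ S, S ||| A ≠ j := by
    rintro S rfl
    exact hj (by rw [Nat.or_assoc, Nat.or_self])
  refine ⟨fun S hS hSj => ?_, fun S hS hSj => ?_, fun T hT hTne => ?_⟩
  · by_cases hSj' : S = j
    · subst hSj'
      rw [hE]
      exact (h.le_of_ge S hS le_rfl).trans (le_max_left _ _)
    · exact (h.le_of_lt S hS (by omega)).trans (hmono _ (hne S))
  · exact (h.le_of_ge S hS (by omega)).trans (hmono _ (by omega))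
  · have hTj : T ≠ j := by
      rintro rfl
      exact hTne hEj
    have key : E' T = E T → ∃ S < 2 ^ τ, D S = E' T ∧ (S ||| A = T ∨ (S = T ∧ j + 1 ≤ T)) := by
      intro hTE
      rw [hTE] at hTne ⊢
      obtain ⟨S, hS, h1, h2⟩ := h.exists_eq T hT hTne
      exact ⟨S, hS, h1, by omega⟩
    by_cases hTA : T = j ||| A
    · rcases max_choice (E j) (E (j ||| A)) with hm | hm
      · rw [hTA, hE, hm] at hTne ⊢
        obtain ⟨S, hS, h1, h2⟩ := h.exists_eq j hjτ hTne
        refine ⟨S, hS, h1, Or.inl ?_⟩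
        rcases h2 with h2 | ⟨h2, -⟩
        · exact absurd h2 (hne S)
        · rw [h2]
      · exact key (by rw [hTA, hE, hm])
    · exact key (hEo T hTj hTA)

lemma orLoop_spec {τ A : ℕ} (hN : s.reg 3 = 2 ^ τ) (h7 : s.reg 7 = 1) (h8 : s.reg 8 = 0)
    (hp : s.reg 12 = p) (hA : s.reg 13 = A) (hAτ : A < 2 ^ τ) (hpN : p + 2 ^ τ < 2 ^ w)
    (hQ : ∀ t' s', t' ≤ t + 2 ^ τ * 15 + 3 → (∀ i < 20, s'.reg i = s.reg i) →
      AddsLetters τ A (fun S => s.mem (p + S)) (fun S => s'.mem (p + S)) →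
      (∀ a, a < p ∨ p + 2 ^ τ ≤ a → s'.mem a = s.mem a) → Q t' s') :
    Wp w orLoop Q t s := by
  refine Wp.forLt (fun j m =>
    AddsLettersUpTo τ A j (fun S => s.mem (p + S)) (fun S => m (p + S)) ∧
    ∀ a, a < p ∨ p + 2 ^ τ ≤ a → m a = s.mem a)
    (2 ^ τ) 12 (by norm_num) hN h7 (by omega) ⟨AddsLettersUpTo.zero _ _ _, fun _ _ => rfl⟩ ?_
    (fun t' s' ht hr hJ => hQ t' s' ht hr hJ.1.addsLetters hJ.2)
  rintro j hj s' t' hr h20 ⟨hJ, hJ'⟩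
  have h8' := (hr 8 (by norm_num)).trans h8
  have hp' := (hr 12 (by norm_num)).trans hp
  have hA' := (hr 13 (by norm_num)).trans hA
  have hjA : j ||| A < 2 ^ τ := Nat.or_lt_two_pow hj hAτ
  have e0 : (j ||| A) % 2 ^ w = j ||| A := Nat.mod_eq_of_lt (by omega)
  have e1 : (p + j) % 2 ^ w = p + j := Nat.mod_eq_of_lt (by omega)
  have e2 : (p + (j ||| A)) % 2 ^ w = p + (j ||| A) := Nat.mod_eq_of_lt (by omega)
  refine Wp.seq (Wp.op (Wp.ifEq (fun h => Wp.skip ?_) fun h => ?_))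
  · simp [BinOp.eval, hA', h20, e0] at h
    refine ⟨by omega, ?_, by simpa using h20, hJ.succ_of_eq h, hJ'⟩
    intro i hi
    rw [← hr i hi]
    simp (disch := omega) only [Function.update_of_ne]
  · simp [BinOp.eval, hA', h20, e0] at h
    refine Wp.seq (Wp.op (Wp.seq (Wp.load (Wp.seq (Wp.op (Wp.seq (Wp.load (Wp.seq
      (Wp.ifLt (fun h' => Wp.store (Wp.store ?_)) fun h' => Wp.skip (Wp.store ?_))))))))))
    all_goals
      simp [BinOp.eval, hp', h8', hA', h20, e0, e1, e2] at h' ⊢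
      refine ⟨?_, hJ.succ hj h ?_ ?_ ?_, ?_⟩
      · intro i hi
        simp (disch := omega) only [Function.update_of_ne]
        exact hr i hi
      all_goals
        simp only [Function.update_apply]
        grind

lemma completeArch_spec {τ k B : ℕ} (h5 : s.reg 5 = k + 1) (h6 : s.reg 6 = 2 ^ τ - 1)
    (h7 : s.reg 7 = 1) (h8 : s.reg 8 = 0) (hp : s.reg 12 = p) (hB : s.reg 14 = B)
    (hBτ : B < 2 ^ τ - 1) (hk : k + 1 < 2 ^ w) (hpN : p + 2 ^ τ < 2 ^ w)
    (hQ : ∀ t' s', t' ≤ t + 20 → (∀ i < 20, s'.reg i = s.reg i) →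
      CompletesArch τ k B (fun S => s.mem (p + S)) (fun S => s'.mem (p + S)) →
      (∀ a, a < p ∨ p + 2 ^ τ ≤ a → s'.mem a = s.mem a) → Q t' s') :
    Wp w completeArch Q t s := by
  have e1 : (p + (2 ^ τ - 1)) % 2 ^ w = p + (2 ^ τ - 1) := Nat.mod_eq_of_lt (by omega)
  have e2 : (p + B) % 2 ^ w = p + B := Nat.mod_eq_of_lt (by omega)
  -- The paths through the two comparisons end in one of two memories, depending on whether the new
  -- entry `u` beats the old one at `B`.
  have hgoal : ∀ u m, s.mem (p + (2 ^ τ - 1)) ≠ 0 →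
      u = (if s.mem (p + (2 ^ τ - 1)) < k + 1 then s.mem (p + (2 ^ τ - 1)) + 1
        else s.mem (p + (2 ^ τ - 1))) →
      (m = Function.update (Function.update s.mem (p + (2 ^ τ - 1)) 0) (p + B) u ∧
        s.mem (p + B) < u ∨
        m = Function.update s.mem (p + (2 ^ τ - 1)) 0 ∧ u ≤ s.mem (p + B)) →
      CompletesArch τ k B (fun S => s.mem (p + S)) (fun S => m (p + S)) ∧
        ∀ a, a < p ∨ p + 2 ^ τ ≤ a → m a = s.mem a := by
    intro u m hv hu hm
    constructor
    · refine CompletesArch.of_eq hBτ fun S hS => ?_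
      rw [← hu]
      rcases hm with ⟨rfl, hm⟩ | ⟨rfl, hm⟩
      all_goals
        simp only [Function.update_apply]
        grind
    · intro a ha
      rcases hm with ⟨rfl, -⟩ | ⟨rfl, -⟩
      all_goals
        simp only [Function.update_apply]
        grind
  have hne : p + B ≠ p + (2 ^ τ - 1) := by omega
  refine Wp.seq (Wp.op (Wp.seq (Wp.load (Wp.ifEq (fun h => Wp.skip ?_) fun h => ?_))))
  · simp [BinOp.eval, h6, h8, hp, e1] at h
    refine hQ _ _ (by omega) ?_ (CompletesArch.of_eq hBτ fun S hS => ?_) (by simp)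
    · intro i hi
      simp (disch := omega) only [Function.update_of_ne]
    · simp only [h]
      grind
  · simp [BinOp.eval, h6, h8, hp, e1] at h ⊢
    refine Wp.seq (Wp.ifLt (fun h₁ => Wp.op ?_) fun h₁ => Wp.skip ?_)
    all_goals
      refine Wp.seq (Wp.store (Wp.seq (Wp.op (Wp.seq (Wp.load (Wp.ifLt
        (fun h₂ => Wp.store ?_) fun h₂ => Wp.skip ?_))))))
    all_goals
      simp [h5] at h₁
      try have e3 : (s.mem (p + (2 ^ τ - 1)) + 1) % 2 ^ w = s.mem (p + (2 ^ τ - 1)) + 1 :=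
        Nat.mod_eq_of_lt (by omega)
      simp [BinOp.eval, h7, h8, hp, hB, e2] at h₂ ⊢
      rw [Function.update_of_ne hne] at h₂
      try rw [e3] at h₂ ⊢
      first
        | obtain ⟨hg₁, hg₂⟩ := hgoal _ _ h (by split <;> omega) (Or.inl ⟨rfl, h₂⟩)
        | obtain ⟨hg₁, hg₂⟩ := hgoal _ _ h (by split <;> omega) (Or.inr ⟨rfl, h₂⟩)
      refine hQ _ _ (by omega) ?_ hg₁ hg₂
      intro i hi
      simp (disch := omega) only [Function.update_of_ne]

end

section

open scoped Computability

open WordRAM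

variable {w τ k n i b p : ℕ} {Q : ℕ → Store → Prop} {t : ℕ} {s : Store}

/-! ### The program

Registers: `1` the cap `k`, `2` the length `n`, `3` the table size `2 ^ τ`, `4` the frame size
`2 ^ τ + 2`, `5` the number `k + 1`, `6` the mask `2 ^ τ - 1`, `7` and `8` the constants `1` and
`0`, `9` the number `2 ^ τ + 1`, `10` the position in the expression, `11` the current frame. A
frame consists of a table of states, the letter mask of the part of the current alternative that
has been read, and the letter mask of the previous alternative. The registers from `12` on are
for temporary values. -/

/-- Process `∅`. -/
def emptyCmd : Cmd := clearLoop ;; .op .add 10 10 7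

/-- Process `ε`. -/
def epsCmd : Cmd := .op .add 10 10 7

/-- Process an opening parenthesis. -/
def lparCmd : Cmd :=
  .op .add 12 11 4 ;; copyLoop ;; .op .add 21 12 3 ;; .store 21 3 ;; .op .add 21 21 7 ;;
    .store 21 8 ;; .op .add 11 12 8 ;; .op .add 10 10 7

/-- Process `|`. -/
def barCmd : Cmd :=
  .op .sub 12 11 4 ;; swapLoop ;; .op .add 21 11 3 ;; .load 22 21 ;; .store 21 3 ;;
    .op .add 21 21 7 ;; .store 21 22 ;; .op .add 10 10 7

/-- Read words that consist of the letters in register `13`, in the table at register `12`. -/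
def starTable : Cmd :=
  orLoop ;;
    .ifEq 13 6
      (.op .add 21 12 6 ;; .load 22 21 ;; .ifEq 22 8 .skip (.store 21 5) ;; .const 14 0)
      (.op .add 14 13 8) ;;
    completeArch

/-- Return to the frame at register `12`, and append a language with the letter mask in
register `15`. -/
def popFrame : Cmd :=
  .op .add 21 12 3 ;; .load 22 21 ;;
    .ifEq 22 8 .skip (.ifEq 15 8 (.store 21 8) (.op .or 22 22 15 ;; .store 21 22)) ;;
    .op .add 11 12 8

/-- Process a closing parenthesis, and `*` if it follows. -/
def rparCmd : Cmd :=
  .op .sub 12 11 4 ;; .op .add 21 11 3 ;; .load 15 21 ;; .op .add 21 21 7 ;; .load 22 21 ;;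
    .op .or 15 15 22 ;; .op .add 10 10 7 ;; .load 22 10 ;; .const 23 5 ;;
    .ifEq 22 23
      (.op .and 13 15 6 ;; .op .or 15 15 3 ;; starTable ;; .op .add 10 10 7)
      maxLoop ;;
    popFrame

/-- Process a letter, whose code is in register `20`. -/
def letterCmd : Cmd :=
  .const 21 6 ;; .op .sub 21 20 21 ;; .op .shl 13 7 21 ;; .op .add 12 11 8 ;; .const 14 0 ;;
    orLoop ;; completeArch ;; .op .add 21 11 3 ;; .load 22 21 ;;
    .ifEq 22 8 .skip (.op .or 22 22 13 ;; .store 21 22) ;; .op .add 10 10 7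

/-- Process one symbol. -/
def symbolCmd : Cmd :=
  .load 20 10 ;;
    .ifEq 20 8 emptyCmd (.ifEq 20 7 epsCmd
      (.const 21 2 ;; .ifEq 20 21 lparCmd
        (.const 21 3 ;; .ifEq 20 21 rparCmd
          (.const 21 4 ;; .ifEq 20 21 barCmd letterCmd))))

/-- Process all symbols. -/
def mainLoop : Cmd := .whileLt 10 2 symbolCmd

/-- The part of the program for the symbol with the given code. -/
def handler : ℕ → Cmd
  | 0 => emptyCmd
  | 1 => epsCmd
  | 2 => lparCmd
  | 3 => rparCmd
  | 4 => barCmd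
  | _ => letterCmd

/-! ### Machine invariants, and the symbols `∅`, `ε`, `(` and `|` -/

/-- The parameters fit into words. -/
structure Params (w τ k n : ℕ) : Prop where
  pos : 0 < τ
  cap_lt : k + 1 < 2 ^ w
  size_le : (n + 1) + (n + 2) * (2 ^ τ + 2) ≤ 2 ^ w

/-- The registers while position `i` is processed with the current frame at `b`. -/
structure Env (τ k n i b : ℕ) (s : Store) : Prop where
  h1 : s.reg 1 = k
  h2 : s.reg 2 = n
  h3 : s.reg 3 = 2 ^ τ
  h4 : s.reg 4 = 2 ^ τ + 2
  h5 : s.reg 5 = k + 1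
  h6 : s.reg 6 = 2 ^ τ - 1
  h7 : s.reg 7 = 1
  h8 : s.reg 8 = 0
  h9 : s.reg 9 = 2 ^ τ + 1
  h10 : s.reg 10 = i
  h11 : s.reg 11 = b

lemma Env.congr {i' b' : ℕ} {s' : Store} (h : Env τ k n i b s)
    (hr : ∀ j < 10, s'.reg j = s.reg j) (h10 : s'.reg 10 = i') (h11 : s'.reg 11 = b') :
    Env τ k n i' b' s' where
  h1 := (hr 1 (by norm_num)).trans h.h1
  h2 := (hr 2 (by norm_num)).trans h.h2
  h3 := (hr 3 (by norm_num)).trans h.h3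
  h4 := (hr 4 (by norm_num)).trans h.h4
  h5 := (hr 5 (by norm_num)).trans h.h5
  h6 := (hr 6 (by norm_num)).trans h.h6
  h7 := (hr 7 (by norm_num)).trans h.h7
  h8 := (hr 8 (by norm_num)).trans h.h8
  h9 := (hr 9 (by norm_num)).trans h.h9
  h10 := h10
  h11 := h11

lemma Params.two_le (h : Params w τ k n) : 2 ≤ 2 ^ τ := by
  have := Nat.pow_le_pow_right (n := 2) (by norm_num) h.pos
  simpa using this

lemma Params.bound (h : Params w τ k n) : n + 2 * 2 ^ τ + 5 ≤ 2 ^ w := by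
  have h1 := h.size_le
  have : 2 * (2 ^ τ + 2) ≤ (n + 2) * (2 ^ τ + 2) := Nat.mul_le_mul_right _ (by omega)
  omega

/-- The handler is reached after at most ten steps. The jumps out of the nested else branches,
together with the jump back, number between one and six depending on the symbol, so the continuation
must tolerate every such delay. -/
lemma mainLoop_step (hP : Params w τ k n) (hE : Env τ k n i b s) (hi : i < n)
    (hQ : ∀ t' s', t' ≤ t + 10 → (∀ j < 20, s'.reg j = s.reg j) → s'.mem = s.mem →
      s'.reg 20 = s.mem i → Wp w (handler (s.mem i))
        (fun t'' s'' => ∀ t₃ ≤ t'' + 6, Wp w mainLoop Q t₃ s'') t' s') :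
    Wp w mainLoop Q t s := by
  have hb := hP.bound
  have h2 := hP.two_le
  have e2 : 2 % 2 ^ w = 2 := Nat.mod_eq_of_lt (by omega)
  have e3 : 3 % 2 ^ w = 3 := Nat.mod_eq_of_lt (by omega)
  have e4 : 4 % 2 ^ w = 4 := Nat.mod_eq_of_lt (by omega)
  have key : ∀ d ≤ 6, ∀ c t' s', handler (s.mem i) = c → t' ≤ t + 10 →
      (∀ j < 20, s'.reg j = s.reg j) → s'.mem = s.mem → s'.reg 20 = s.mem i →
      Wp w c (fun t'' s'' => Wp w mainLoop Q (t'' + d) s'') t' s' := by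
    rintro d hd c t' s' rfl ht hr hm h20
    exact (hQ t' s' ht hr hm h20).mono fun t'' s'' h => h _ (by omega)
  refine Wp.whileLt_step (by rw [hE.h10, hE.h2]; exact hi) (Wp.seq (Wp.load ?_))
  refine Wp.ifEq (fun h0 => ?_) fun h0 => Wp.ifEq (fun h1 => ?_) fun h1 => Wp.seq (Wp.const
    (Wp.ifEq (fun h2 => ?_) fun h2 => Wp.seq (Wp.const (Wp.ifEq (fun h3 => ?_) fun h3 =>
    Wp.seq (Wp.const (Wp.ifEq (fun h4 => ?_) fun h4 => ?_))))))
  · simp [hE.h10, hE.h8] at h0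
    refine key 1 (by omega) _ _ _ (by rw [h0]; rfl) (by omega) ?_ rfl (by simp [hE.h10])
    intro j hj
    simp (disch := omega) only [Function.update_of_ne]
  · simp [hE.h10, hE.h7] at h1
    refine key 2 (by omega) _ _ _ (by rw [h1]; rfl) (by omega) ?_ rfl (by simp [hE.h10])
    intro j hj
    simp (disch := omega) only [Function.update_of_ne]
  · simp [hE.h10, e2] at h2
    refine key 3 (by omega) _ _ _ (by rw [h2]; rfl) (by omega) ?_ rfl (by simp [hE.h10])
    intro j hj
    simp (disch := omega) only [Function.update_of_ne]
  · simp [hE.h10, e3] at h3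
    refine key 4 (by omega) _ _ _ (by rw [h3]; rfl) (by omega) ?_ rfl (by simp [hE.h10])
    intro j hj
    simp (disch := omega) only [Function.update_of_ne]
  · simp [hE.h10, e4] at h4
    refine key 5 (by omega) _ _ _ (by rw [h4]; rfl) (by omega) ?_ rfl (by simp [hE.h10])
    intro j hj
    simp (disch := omega) only [Function.update_of_ne]
  · simp [hE.h10, hE.h8] at h0
    simp [hE.h10, hE.h7] at h1
    simp [hE.h10, e2] at h2
    simp [hE.h10, e3] at h3
    simp [hE.h10, e4] at h4
    refine key 6 (by omega) _ _ _ ?_ (by omega) ?_ rfl (by simp [hE.h10])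
    · unfold handler
      split <;> first | contradiction | rfl
    · intro j hj
      simp (disch := omega) only [Function.update_of_ne]

lemma mainLoop_empty (hP : Params w τ k n) (hE : Env τ k n i b s) (hi : i < n)
    (hs : s.mem i = 0) (hb : b + (2 ^ τ + 2) ≤ 2 ^ w)
    (hQ : ∀ t' s', t' ≤ t + 60 * 2 ^ τ → Env τ k n (i + 1) b s' →
      (∀ S < 2 ^ τ + 1, s'.mem (b + S) = 0) →
      (∀ a, a < b ∨ a = b + 2 ^ τ + 1 → s'.mem a = s.mem a) → Wp w mainLoop Q t' s') :
    Wp w mainLoop Q t s := by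
  have hbd := hP.bound
  have h2 := hP.two_le
  refine mainLoop_step hP hE hi fun t₁ s₁ ht₁ hr₁ hm₁ _ => ?_
  rw [hs]
  -- One cell more than the table: the letter mask is cleared too, as mask `0` means the empty
  -- language.
  refine Wp.seq (clearLoop_spec (N := 2 ^ τ + 1) (b := b) ?_ ?_ ?_ ?_ (by omega) (by omega) ?_)
  · exact (hr₁ 9 (by norm_num)).trans hE.h9
  · exact (hr₁ 7 (by norm_num)).trans hE.h7
  · exact (hr₁ 8 (by norm_num)).trans hE.h8
  · exact (hr₁ 11 (by norm_num)).trans hE.h11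
  · intro t₂ s₂ ht₂ hr₂ h0 hm₂
    have hr : ∀ j < 20, s₂.reg j = s.reg j := fun j hj => (hr₂ j hj).trans (hr₁ j hj)
    refine Wp.op fun t₃ ht₃ => hQ t₃ _ (by omega) (hE.congr ?_ ?_ ?_) h0 ?_
    · intro j hj
      dsimp only
      rw [Function.update_of_ne (by omega), hr j (by omega)]
    · simp only [Function.update_self, BinOp.eval, hr 10 (by omega), hr 7 (by omega), hE.h10,
        hE.h7]
      exact Nat.mod_eq_of_lt (by omega)
    · dsimp only
      rw [Function.update_of_ne (by omega), hr 11 (by omega), hE.h11]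
    · intro a ha
      exact (hm₂ a (by omega)).trans (by rw [hm₁])

lemma mainLoop_eps (hP : Params w τ k n) (hE : Env τ k n i b s) (hi : i < n)
    (hs : s.mem i = 1)
    (hQ : ∀ t' s', t' ≤ t + 60 * 2 ^ τ → Env τ k n (i + 1) b s' → s'.mem = s.mem →
      Wp w mainLoop Q t' s') : Wp w mainLoop Q t s := by
  have hbd := hP.bound
  have h2 := hP.two_le
  refine mainLoop_step hP hE hi fun t₁ s₁ ht₁ hr hm₁ _ => ?_
  rw [hs]
  refine Wp.op fun t₃ ht₃ => hQ t₃ _ (by omega) (hE.congr ?_ ?_ ?_) hm₁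
  · intro j hj
    dsimp only
    rw [Function.update_of_ne (by omega), hr j (by omega)]
  · simp only [Function.update_self, BinOp.eval, hr 10 (by omega), hr 7 (by omega), hE.h10,
      hE.h7]
    exact Nat.mod_eq_of_lt (by omega)
  · dsimp only
    rw [Function.update_of_ne (by omega), hr 11 (by omega), hE.h11]

/-- The lower frame keeps the table as it is at the parenthesis, since a second alternative or a
star has to start from it again. The new mask `2 ^ τ` is that of the empty word, and `0` stands for
the absence of a previous alternative. -/
lemma mainLoop_lpar (hP : Params w τ k n) (hE : Env τ k n i b s) (hi : i < n)
    (hs : s.mem i = 2) (hb : b + (2 ^ τ + 2) + (2 ^ τ + 2) ≤ 2 ^ w)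
    (hQ : ∀ t' s', t' ≤ t + 60 * 2 ^ τ → Env τ k n (i + 1) (b + (2 ^ τ + 2)) s' →
      (∀ S < 2 ^ τ, s'.mem (b + (2 ^ τ + 2) + S) = s.mem (b + S)) →
      s'.mem (b + (2 ^ τ + 2) + 2 ^ τ) = 2 ^ τ → s'.mem (b + (2 ^ τ + 2) + 2 ^ τ + 1) = 0 →
      (∀ a < b + (2 ^ τ + 2), s'.mem a = s.mem a) → Wp w mainLoop Q t' s') :
    Wp w mainLoop Q t s := by
  have hbd := hP.bound
  have h2 := hP.two_le
  refine mainLoop_step hP hE hi fun t₁ s₁ ht₁ hr₁ hm₁ _ => ?_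
  rw [hs]
  have e1 : (b + (2 ^ τ + 2)) % 2 ^ w = b + (2 ^ τ + 2) := Nat.mod_eq_of_lt (by omega)
  have e2 : (b + (2 ^ τ + 2) + 2 ^ τ) % 2 ^ w = b + (2 ^ τ + 2) + 2 ^ τ :=
    Nat.mod_eq_of_lt (by omega)
  have e3 : (b + (2 ^ τ + 2) + 2 ^ τ + 1) % 2 ^ w = b + (2 ^ τ + 2) + 2 ^ τ + 1 :=
    Nat.mod_eq_of_lt (by omega)
  have e4 : (i + 1) % 2 ^ w = i + 1 := Nat.mod_eq_of_lt (by omega)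
  refine Wp.seq (Wp.op (Wp.seq (copyLoop_spec (N := 2 ^ τ) (b := b) (p := b + (2 ^ τ + 2))
    ?_ ?_ ?_ ?_ (by omega) (by omega) ?_)))
  · simp [hr₁, hE.h3]
  · simp [hr₁, hE.h7]
  · simp [hr₁, hE.h11]
  · simp [hr₁, hE.h11, hE.h4, BinOp.eval, e1]
  intro t₂ s₂ ht₂ hr₂ hc₂ hm₂
  have hr : ∀ j < 12, s₂.reg j = s.reg j := by
    intro j hj
    rw [hr₂ j (by omega)]
    simp (disch := omega) only [Function.update_of_ne, hr₁]
  have h12 : s₂.reg 12 = b + (2 ^ τ + 2) := by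
    rw [hr₂ 12 (by omega)]
    simp [hr₁, hE.h11, hE.h4, BinOp.eval, e1]
  simp only [hm₁] at hc₂ hm₂
  refine Wp.seq (Wp.op (Wp.seq (Wp.store (Wp.seq (Wp.op (Wp.seq (Wp.store (Wp.seq (Wp.op
    (Wp.op ?_))))))))))
  intro t₃ ht₃
  simp [BinOp.eval, hr, h12, hE.h3, hE.h7, hE.h8, hE.h10, e1, e2, e3, e4] at ht₃ ⊢
  refine hQ _ _ (by omega) (hE.congr ?_ ?_ ?_) ?_ ?_ ?_ ?_
  · intro j hj
    simp (disch := omega) only [Function.update_of_ne, hr]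
  · simp
  · simp
  · intro S hS
    simp (disch := omega) only [Function.update_of_ne, hc₂]
  · simp
  · simp
  · intro a ha
    simp (disch := omega) only [Function.update_of_ne, hm₂]

/-- The exchange stores the result of the first alternative in the lower frame and lets the second
one start from the original table. -/
lemma mainLoop_bar (hP : Params w τ k n) (hE : Env τ k n i b s) (hi : i < n)
    (hs : s.mem i = 4) (hpb : p + (2 ^ τ + 2) = b) (hb : b + (2 ^ τ + 2) ≤ 2 ^ w)
    (hQ : ∀ t' s', t' ≤ t + 60 * 2 ^ τ → Env τ k n (i + 1) b s' →
      (∀ S < 2 ^ τ, s'.mem (p + S) = s.mem (b + S)) →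
      (∀ S < 2 ^ τ, s'.mem (b + S) = s.mem (p + S)) →
      s'.mem (b + 2 ^ τ) = 2 ^ τ → s'.mem (b + 2 ^ τ + 1) = s.mem (b + 2 ^ τ) →
      (∀ a, a < p ∨ (p + 2 ^ τ ≤ a ∧ a < b) → s'.mem a = s.mem a) → Wp w mainLoop Q t' s') :
    Wp w mainLoop Q t s := by
  have hbd := hP.bound
  have h2 := hP.two_le
  refine mainLoop_step hP hE hi fun t₁ s₁ ht₁ hr₁ hm₁ _ => ?_
  rw [hs]
  have e1 : (b + 2 ^ w - (2 ^ τ + 2)) % 2 ^ w = p := by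
    rw [show b + 2 ^ w - (2 ^ τ + 2) = p + 2 ^ w by omega, Nat.add_mod_right]
    exact Nat.mod_eq_of_lt (by omega)
  have e2 : (b + 2 ^ τ) % 2 ^ w = b + 2 ^ τ := Nat.mod_eq_of_lt (by omega)
  have e3 : (b + 2 ^ τ + 1) % 2 ^ w = b + 2 ^ τ + 1 := Nat.mod_eq_of_lt (by omega)
  have e4 : (i + 1) % 2 ^ w = i + 1 := Nat.mod_eq_of_lt (by omega)
  refine Wp.seq (Wp.op (Wp.seq (swapLoop_spec (N := 2 ^ τ) (b := b) (p := p)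
    ?_ ?_ ?_ ?_ (by omega) (by omega) ?_)))
  · simp [hr₁, hE.h3]
  · simp [hr₁, hE.h7]
  · simp [hr₁, hE.h11]
  · simp [hr₁, hE.h11, hE.h4, BinOp.eval, e1]
  intro t₂ s₂ ht₂ hr₂ hp₂ hb₂ hm₂
  have hr : ∀ j < 12, s₂.reg j = s.reg j := by
    intro j hj
    rw [hr₂ j (by omega)]
    simp (disch := omega) only [Function.update_of_ne, hr₁]
  simp only [hm₁] at hp₂ hb₂ hm₂
  have hN := hm₂ (b + 2 ^ τ) (by omega) (by omega)
  refine Wp.seq (Wp.op (Wp.seq (Wp.load (Wp.seq (Wp.store (Wp.seq (Wp.op (Wp.seq (Wp.store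
    (Wp.op ?_))))))))))
  intro t₃ ht₃
  simp [BinOp.eval, hr, hE.h3, hE.h7, hE.h10, hE.h11, hN, e2, e3, e4] at ht₃ ⊢
  refine hQ _ _ (by omega) (hE.congr ?_ ?_ ?_) ?_ ?_ ?_ ?_ ?_
  · intro j hj
    simp (disch := omega) only [Function.update_of_ne, hr]
  · simp
  · simp [hr, hE.h11]
  · intro S hS
    simp (disch := omega) only [Function.update_of_ne, hp₂]
  · intro S hS
    simp (disch := omega) only [Function.update_of_ne, hb₂]
  · simp
  · simp
  · intro a ha
    simp (disch := omega) only [Function.update_of_ne]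
    exact hm₂ a (by omega) (by omega)

end

/-! ### Stars, closing parentheses and letters -/

section

open scoped Computability

open WordRAM

variable {σ w τ k n i b p : ℕ} {Q : ℕ → Store → Prop} {t : ℕ} {s : Store}

lemma starTable_spec {L : Language (Fin σ)} {A y : ℕ} (hP : Params w τ k n) (hστ : σ ≤ τ)
    (hE : Env τ k n i b s) (hp : s.reg 12 = p) (hA : s.reg 13 = A)
    (hL : LetterMask τ L y) (hy : y &&& (2 ^ τ - 1) = A) (hpN : p + 2 ^ τ < 2 ^ w)
    (hD : s.mem (p + (2 ^ τ - 1)) = 0)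
    (hQ : ∀ t' s', t' ≤ t + 2 ^ τ * 15 + 40 → (∀ j < 20, j ≠ 14 → s'.reg j = s.reg j) →
      Transfers τ k (fun S => s.mem (p + S)) L∗ (fun S => s'.mem (p + S)) →
      (∀ a, a < p ∨ p + 2 ^ τ ≤ a → s'.mem a = s.mem a) → Q t' s') :
    Wp w starTable Q t s := by
  have h2 := hP.two_le
  have hbd := hP.bound
  have hAlt : A < 2 ^ τ := by
    rw [← hy]
    exact Nat.and_lt_two_pow _ (two_pow_sub_one_lt τ)
  have hex := hL.exists_wordMask_eq hστ
  rw [hy] at hex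
  refine Wp.seq (orLoop_spec hE.h3 hE.h7 hE.h8 hp hA hAlt hpN ?_)
  intro t₁ s₁ ht₁ hr₁ hadd hm₁
  have e1 : (p + (2 ^ τ - 1)) % 2 ^ w = p + (2 ^ τ - 1) := Nat.mod_eq_of_lt (by omega)
  -- The two cases are `Transfers.star_of_full` and `Transfers.star_of_ne_full`.
  refine Wp.seq (Wp.ifEq (fun h => ?_) fun h => ?_)
  · have hAf : A = 2 ^ τ - 1 := by
      rw [hr₁ 13 (by norm_num), hr₁ 6 (by norm_num), hA, hE.h6] at h
      exact h
    have key : ∀ t₂ s₂, t₂ ≤ t₁ + 10 → (∀ j < 20, j ≠ 14 → s₂.reg j = s₁.reg j) →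
        s₂.reg 14 = 0 → (∀ a, a ≠ p + (2 ^ τ - 1) → s₂.mem a = s₁.mem a) →
        s₂.mem (p + (2 ^ τ - 1)) = (if s₁.mem (p + (2 ^ τ - 1)) = 0 then 0 else k + 1) →
        Wp w completeArch Q t₂ s₂ := by
      intro t₂ s₂ ht₂ hr₂ h14 hm₂ hf
      have hr : ∀ j < 20, j ≠ 14 → s₂.reg j = s.reg j :=
        fun j hj hj' => (hr₂ j hj hj').trans (hr₁ j hj)
      refine completeArch_spec (τ := τ) (k := k) (B := 0) (p := p) ?_ ?_ ?_ ?_ ?_ h14 (by omega)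
        hP.cap_lt hpN ?_
      · rw [hr 5 (by norm_num) (by norm_num), hE.h5]
      · rw [hr 6 (by norm_num) (by norm_num), hE.h6]
      · rw [hr 7 (by norm_num) (by norm_num), hE.h7]
      · rw [hr 8 (by norm_num) (by norm_num), hE.h8]
      · rw [hr 12 (by norm_num) (by norm_num), hp]
      intro t₃ s₃ ht₃ hr₃ hc hm₃
      refine hQ t₃ s₃ (by omega) (fun j hj hj' => (hr₃ j hj).trans (hr j hj hj')) ?_ ?_
      · rw [hAf] at hex hadd
        exact Transfers.star_of_full hP.pos hστ hex hD hadd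
          (fun S hS => hm₂ (p + S) (by omega)) hf hc
      · intro a ha
        rw [hm₃ a ha, hm₂ a (by omega), hm₁ a ha]
    refine Wp.seq (Wp.op (Wp.seq (Wp.load (Wp.seq (Wp.ifEq
      (fun h0 => Wp.skip (Wp.const ?_)) fun h0 => Wp.store (Wp.const ?_))))))
    all_goals
      simp [BinOp.eval, hr₁, hE.h5, hE.h6, hE.h8, hp, e1] at h0 ⊢
      refine key _ _ (by omega) ?_ (by simp) ?_ ?_
      · intro j hj hj'
        simp (disch := omega) only [Function.update_of_ne]
      · intro a ha
        simp [ha]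
      · simp [h0]
  · have hAf : A ≠ 2 ^ τ - 1 := by
      rw [hr₁ 13 (by norm_num), hr₁ 6 (by norm_num), hA, hE.h6] at h
      exact h
    refine Wp.op ?_
    have e2 : A % 2 ^ w = A := Nat.mod_eq_of_lt (by omega)
    simp [BinOp.eval, hr₁, hA, hE.h8, e2]
    refine completeArch_spec (τ := τ) (k := k) (B := A) (p := p) ?_ ?_ ?_ ?_ ?_ ?_ (by omega)
        hP.cap_lt hpN ?_
    · simp [hr₁, hE.h5]
    · simp [hr₁, hE.h6]
    · simp [hr₁, hE.h7]
    · simp [hr₁, hE.h8]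
    · simp [hr₁, hp]
    · simp
    intro t₃ s₃ ht₃ hr₃ hc hm₃
    refine hQ _ s₃ (by omega) ?_ ?_ ?_
    · intro j hj hj'
      rw [hr₃ j hj]
      simp (disch := omega) only [Function.update_of_ne, hr₁]
    · refine Transfers.star_of_ne_full hP.pos hστ (by omega) hex ?_ hD hadd hc
      intro v hv
      rw [← hy]
      exact hL.wordMask_or hστ hv
    · intro a ha
      exact (hm₃ a ha).trans (hm₁ a ha)

lemma popFrame_spec {y : ℕ} (hP : Params w τ k n) (hE : Env τ k n i b s) (hp : s.reg 12 = p)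
    (hy : s.reg 15 = y) (hyw : y < 2 ^ w) (hpw : p + 2 ^ τ < 2 ^ w)
    (hzw : s.mem (p + 2 ^ τ) < 2 ^ w)
    (hQ : ∀ t' s', t' ≤ t + 12 → Env τ k n i p s' →
      s'.mem (p + 2 ^ τ) =
        (if s.mem (p + 2 ^ τ) = 0 ∨ y = 0 then 0 else s.mem (p + 2 ^ τ) ||| y) →
      (∀ a, a ≠ p + 2 ^ τ → s'.mem a = s.mem a) → Q t' s') :
    Wp w popFrame Q t s := by
  have h2 := hP.two_le
  have e1 : (p + 2 ^ τ) % 2 ^ w = p + 2 ^ τ := Nat.mod_eq_of_lt hpw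
  have e2 : p % 2 ^ w = p := Nat.mod_eq_of_lt (by omega)
  have e3 : (s.mem (p + 2 ^ τ) ||| y) % 2 ^ w = s.mem (p + 2 ^ τ) ||| y :=
    Nat.mod_eq_of_lt (Nat.or_lt_two_pow hzw hyw)
  refine Wp.seq (Wp.op (Wp.seq (Wp.load (Wp.seq (Wp.ifEq (fun h => Wp.skip (Wp.op ?_)) fun h =>
    Wp.ifEq (fun h' => Wp.store (Wp.op ?_))
      fun h' => Wp.seq (Wp.op (Wp.store (Wp.op ?_))))))))
  all_goals
    simp [BinOp.eval, hE.h3, hE.h8, hp, e1] at h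
    try simp [hE.h8, hy] at h'
    simp [BinOp.eval, hE.h3, hE.h8, hp, hy, e1, e2, e3]
    refine hQ _ _ (by omega) (hE.congr ?_ ?_ ?_) ?_ ?_
    · intro j hj
      simp (disch := omega) only [Function.update_of_ne]
    · simp [hE.h10]
    · simp
    · simp [*]
    · intro a ha
      simp [ha]

/-- The first part of `rparCmd`. -/
lemma mainLoop_rpar_aux {c : Cmd} (hP : Params w τ k n) (hE : Env τ k n i b s) (hi : i < n)
    (hpb : p + (2 ^ τ + 2) = b) (hb : b + (2 ^ τ + 2) ≤ 2 ^ w)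
    {y : ℕ} (hy : s.mem (b + 2 ^ τ) ||| s.mem (b + 2 ^ τ + 1) = y) (hyw : y < 2 ^ w)
    (hQ : ∀ s', Env τ k n (i + 1) b s' → s'.reg 12 = p → s'.reg 15 = y →
      s'.reg 22 = s.mem (i + 1) → s'.reg 23 = 5 → s'.mem = s.mem →
      Wp w c Q (t + 9) s') :
    Wp w (.op .sub 12 11 4 ;; .op .add 21 11 3 ;; .load 15 21 ;; .op .add 21 21 7 ;;
      .load 22 21 ;; .op .or 15 15 22 ;; .op .add 10 10 7 ;; .load 22 10 ;; .const 23 5 ;; c)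
      Q t s := by
  have hbd := hP.bound
  have h2 := hP.two_le
  have e1 : (b + 2 ^ w - (2 ^ τ + 2)) % 2 ^ w = p := by
    rw [show b + 2 ^ w - (2 ^ τ + 2) = p + 2 ^ w by omega, Nat.add_mod_right]
    exact Nat.mod_eq_of_lt (by omega)
  have e2 : (b + 2 ^ τ) % 2 ^ w = b + 2 ^ τ := Nat.mod_eq_of_lt (by omega)
  have e3 : (b + 2 ^ τ + 1) % 2 ^ w = b + 2 ^ τ + 1 := Nat.mod_eq_of_lt (by omega)
  have e4 : (i + 1) % 2 ^ w = i + 1 := Nat.mod_eq_of_lt (by omega)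
  have e5 : 5 % 2 ^ w = 5 := Nat.mod_eq_of_lt (by omega)
  have e6 : y % 2 ^ w = y := Nat.mod_eq_of_lt hyw
  refine Wp.seq (Wp.op (Wp.seq (Wp.op (Wp.seq (Wp.load (Wp.seq (Wp.op (Wp.seq (Wp.load
    (Wp.seq (Wp.op (Wp.seq (Wp.op (Wp.seq (Wp.load (Wp.seq (Wp.const ?_)))))))))))))))))
  simp [BinOp.eval, hE.h3, hE.h4, hE.h7, hE.h10, hE.h11, e1, e2, e3, e4, e5, hy, e6]
  refine hQ _ (hE.congr ?_ ?_ ?_) ?_ ?_ ?_ ?_ rfl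
  · intro j hj
    simp (disch := omega) only [Function.update_of_ne]
  · simp
  · simp [hE.h11]
  · simp
  · simp
  · simp
  · simp

lemma Params.pow_succ_le (hP : Params w τ k n) : 2 ^ (τ + 1) ≤ 2 ^ w := by
  have := hP.bound
  rw [pow_succ]
  omega

/-- At the end of an alternation the lower table belongs to the first alternative and the upper one
to the second. The masks of both are joined before they are appended to the mask `L₀` of the
surrounding expression. -/
lemma mainLoop_rpar {L M L₀ : Language (Fin σ)} (hP : Params w τ k n)
    (hE : Env τ k n i b s) (hi : i < n)
    (hs : s.mem i = 3) (hs' : s.mem (i + 1) ≠ 5) (hpb : p + (2 ^ τ + 2) = b)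
    (hb : b + (2 ^ τ + 2) ≤ 2 ^ w)
    (hL : LetterMask τ L (s.mem (b + 2 ^ τ + 1))) (hM : LetterMask τ M (s.mem (b + 2 ^ τ)))
    (hL₀ : LetterMask τ L₀ (s.mem (p + 2 ^ τ)))
    (hQ : ∀ t' s', t' ≤ t + 60 * 2 ^ τ → Env τ k n (i + 1) p s' →
      (∀ S < 2 ^ τ, s'.mem (p + S) = max (s.mem (p + S)) (s.mem (b + S))) →
      LetterMask τ (L₀ * (L + M)) (s'.mem (p + 2 ^ τ)) →
      (∀ a, a < p ∨ a = p + 2 ^ τ + 1 → s'.mem a = s.mem a) → Wp w mainLoop Q t' s') :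
    Wp w mainLoop Q t s := by
  have hbd := hP.bound
  have h2 := hP.two_le
  have hpow := hP.pow_succ_le
  refine mainLoop_step hP hE hi fun t₁ s₁ ht₁ hr₁ hm₁ _ => ?_
  rw [hs]
  have hy := hL.add hM
  rw [Nat.or_comm, ← hm₁] at hy
  refine mainLoop_rpar_aux hP (hE.congr (fun j hj => hr₁ j (by omega))
    ((hr₁ 10 (by norm_num)).trans hE.h10) ((hr₁ 11 (by norm_num)).trans hE.h11)) hi hpb hb rfl
    (lt_of_lt_of_le hy.lt hpow) ?_
  intro s₂ hE₂ h12 h15 h22 h23 hm₂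
  rw [hm₁] at hm₂ h22
  refine Wp.seq (Wp.ifEq (fun h => absurd (by rw [← h22, h, h23]) hs') fun _ => ?_)
  refine maxLoop_spec (N := 2 ^ τ) (b := b) (p := p) hE₂.h3 hE₂.h7 hE₂.h11 h12 (by omega)
    (by omega) ?_
  intro t₃ s₃ ht₃ hr₃ hmax hm₃
  rw [hm₂] at hmax hm₃
  have hz : s₃.mem (p + 2 ^ τ) = s.mem (p + 2 ^ τ) := hm₃ _ (by omega)
  refine popFrame_spec (p := p) hP (hE₂.congr (fun j hj => hr₃ j (by omega))
    ((hr₃ 10 (by norm_num)).trans hE₂.h10) ((hr₃ 11 (by norm_num)).trans hE₂.h11))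
    ((hr₃ 12 (by norm_num)).trans h12) ((hr₃ 15 (by norm_num)).trans h15)
    (lt_of_lt_of_le hy.lt hpow) (by omega) (by rw [hz]; exact lt_of_lt_of_le hL₀.lt hpow) ?_
  intro t₄ s₄ ht₄ hE₄ hz₄ hm₄ t₅ ht₅
  refine hQ t₅ s₄ (by omega) hE₄ ?_ ?_ ?_
  · intro S hS
    rw [hm₄ _ (by omega), hmax S hS]
  · rw [hz₄, hz]
    exact hL₀.mul hy
  · intro a ha
    rw [hm₄ _ (by omega), hm₃ a (by omega)]

/-- The star acts on the lower table, unchanged since the opening parenthesis. Only the letter mask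
of the upper frame is used; its table is dropped. -/
lemma mainLoop_star {L L₀ : Language (Fin σ)} (hP : Params w τ k n) (hστ : σ ≤ τ)
    (hE : Env τ k n i b s) (hi : i < n)
    (hs : s.mem i = 3) (hs' : s.mem (i + 1) = 5) (hpb : p + (2 ^ τ + 2) = b)
    (hb : b + (2 ^ τ + 2) ≤ 2 ^ w)
    (hL : LetterMask τ L (s.mem (b + 2 ^ τ))) (h0 : s.mem (b + 2 ^ τ + 1) = 0)
    (hD : s.mem (p + (2 ^ τ - 1)) = 0)
    (hL₀ : LetterMask τ L₀ (s.mem (p + 2 ^ τ)))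
    (hQ : ∀ t' s', t' ≤ t + 60 * 2 ^ τ → Env τ k n (i + 2) p s' →
      Transfers τ k (fun S => s.mem (p + S)) L∗ (fun S => s'.mem (p + S)) →
      LetterMask τ (L₀ * L∗) (s'.mem (p + 2 ^ τ)) →
      (∀ a, a < p ∨ a = p + 2 ^ τ + 1 → s'.mem a = s.mem a) → Wp w mainLoop Q t' s') :
    Wp w mainLoop Q t s := by
  have hbd := hP.bound
  have h2 := hP.two_le
  have hpow := hP.pow_succ_le
  refine mainLoop_step hP hE hi fun t₁ s₁ ht₁ hr₁ hm₁ _ => ?_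
  rw [hs]
  have hyw := lt_of_lt_of_le hL.lt hpow
  refine mainLoop_rpar_aux (y := s.mem (b + 2 ^ τ)) hP (hE.congr (fun j hj => hr₁ j (by omega))
    ((hr₁ 10 (by norm_num)).trans hE.h10) ((hr₁ 11 (by norm_num)).trans hE.h11)) hi hpb hb
    (by rw [hm₁, h0, Nat.or_zero]) hyw ?_
  intro s₂ hE₂ h12 h15 h22 h23 hm₂
  rw [hm₁] at hm₂ h22
  refine Wp.seq (Wp.ifEq (fun _ => ?_) fun h => absurd (by rw [h22, h23, hs']) h)
  refine Wp.seq (Wp.op (Wp.seq (Wp.op (Wp.seq ?_))))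
  have e1 : (s.mem (b + 2 ^ τ) &&& (2 ^ τ - 1)) % 2 ^ w = s.mem (b + 2 ^ τ) &&& (2 ^ τ - 1) :=
    Nat.mod_eq_of_lt (lt_of_le_of_lt Nat.and_le_left hyw)
  have hstar := hL.star
  have e2 : (s.mem (b + 2 ^ τ) ||| 2 ^ τ) % 2 ^ w = s.mem (b + 2 ^ τ) ||| 2 ^ τ :=
    Nat.mod_eq_of_lt (lt_of_lt_of_le hstar.lt hpow)
  simp [BinOp.eval, h15, hE₂.h6, hE₂.h3, e1, e2, -Nat.and_two_pow_sub_one_eq_mod]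
  refine starTable_spec (L := L) (p := p) (i := i + 1) (b := b)
    (A := s.mem (b + 2 ^ τ) &&& (2 ^ τ - 1)) hP hστ
    (hE₂.congr (fun j hj => ?_) ?_ ?_) ?_ ?_ hL rfl (by omega) ?_ ?_
  · simp (disch := omega) only [Function.update_of_ne]
  · simp [hE₂.h10]
  · simp [hE₂.h11]
  · simp [h12]
  · simp [-Nat.and_two_pow_sub_one_eq_mod]
  · simp [hm₂, hD]
  intro t₃ s₃ ht₃ hr₃ htr hm₃
  simp only [hm₂] at htr hm₃
  have e3 : (i + 1 + 1) % 2 ^ w = i + 2 := Nat.mod_eq_of_lt (by omega)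
  have hr : ∀ j < 13, s₃.reg j = s₂.reg j := by
    intro j hj
    rw [hr₃ j (by omega) (by omega)]
    simp (disch := omega) only [Function.update_of_ne]
  have h15' : s₃.reg 15 = s.mem (b + 2 ^ τ) ||| 2 ^ τ := by
    rw [hr₃ 15 (by omega) (by omega)]
    simp
  have hz : s₃.mem (p + 2 ^ τ) = s.mem (p + 2 ^ τ) := hm₃ _ (by omega)
  refine Wp.op ?_
  simp [BinOp.eval, hr, hE₂.h10, hE₂.h7, e3]
  refine popFrame_spec (p := p) (i := i + 2) (b := b) (y := s.mem (b + 2 ^ τ) ||| 2 ^ τ) hP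
    (hE₂.congr (fun j hj => ?_) ?_ ?_) ?_ ?_
    (lt_of_lt_of_le hstar.lt hpow) (by omega)
    (by dsimp only; rw [hz]; exact lt_of_lt_of_le hL₀.lt hpow) ?_
  · simp (disch := omega) only [Function.update_of_ne, hr]
  · simp
  · simp [hr, hE₂.h11]
  · simp [hr, h12]
  · simp [h15']
  intro t₄ s₄ ht₄ hE₄ hz₄ hm₄ t₅ ht₅
  dsimp only at hz₄ hm₄
  refine hQ t₅ s₄ (by omega) hE₄ ?_ ?_ ?_
  · exact htr.congr (fun S hS => rfl) fun S hS => hm₄ _ (by omega)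
  · rw [hz₄, hz]
    exact hL₀.mul hstar
  · intro a ha
    rw [hm₄ _ (by omega), hm₃ a (by omega)]

lemma mainLoop_letter {L₀ : Language (Fin σ)} {a : Fin σ} (hP : Params w τ k n) (hστ : σ ≤ τ)
    (hE : Env τ k n i b s) (hi : i < n)
    (hs : s.mem i = 6 + a.val) (hb : b + (2 ^ τ + 2) ≤ 2 ^ w)
    (hD : s.mem (b + (2 ^ τ - 1)) = 0)
    (hL₀ : LetterMask τ L₀ (s.mem (b + 2 ^ τ)))
    (hQ : ∀ t' s', t' ≤ t + 60 * 2 ^ τ → Env τ k n (i + 1) b s' →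
      Transfers τ k (fun S => s.mem (b + S)) ({[a]} : Language (Fin σ))
        (fun S => s'.mem (b + S)) →
      LetterMask τ (L₀ * {[a]}) (s'.mem (b + 2 ^ τ)) →
      (∀ a, a < b ∨ a = b + 2 ^ τ + 1 → s'.mem a = s.mem a) → Wp w mainLoop Q t' s') :
    Wp w mainLoop Q t s := by
  have hbd := hP.bound
  have h2 := hP.two_le
  have hpow := hP.pow_succ_le
  have ha : a.val < τ := by omega
  have haτ : 2 ^ a.val < 2 ^ τ := Nat.pow_lt_pow_right (by norm_num) ha
  have haτ' : a.val < 2 ^ τ := ha.trans Nat.lt_two_pow_self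
  refine mainLoop_step hP hE hi fun t₁ s₁ ht₁ hr₁ hm₁ h20 => ?_
  have hh : handler (s.mem i) = letterCmd := by
    unfold handler
    split <;> first | omega | rfl
  rw [hh]
  have e0 : 6 % 2 ^ w = 6 := Nat.mod_eq_of_lt (by omega)
  have e1 : (6 + a.val + 2 ^ w - 6) % 2 ^ w = a.val := by
    rw [show 6 + a.val + 2 ^ w - 6 = a.val + 2 ^ w by omega, Nat.add_mod_right]
    exact Nat.mod_eq_of_lt (by omega)
  have e2 : (1 <<< a.val) % 2 ^ w = 2 ^ a.val := by
    rw [Nat.shiftLeft_eq, one_mul]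
    exact Nat.mod_eq_of_lt (by omega)
  have e3 : b % 2 ^ w = b := Nat.mod_eq_of_lt (by omega)
  have e4 : (b + 2 ^ τ) % 2 ^ w = b + 2 ^ τ := Nat.mod_eq_of_lt (by omega)
  have e5 : (i + 1) % 2 ^ w = i + 1 := Nat.mod_eq_of_lt (by omega)
  have e6 : (s.mem (b + 2 ^ τ) ||| 2 ^ a.val) % 2 ^ w = s.mem (b + 2 ^ τ) ||| 2 ^ a.val :=
    Nat.mod_eq_of_lt (Nat.or_lt_two_pow (lt_of_lt_of_le hL₀.lt hpow) (by omega))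
  refine Wp.seq (Wp.const (Wp.seq (Wp.op (Wp.seq (Wp.op (Wp.seq (Wp.op (Wp.seq (Wp.const
    (Wp.seq ?_))))))))))
  simp [BinOp.eval, hr₁, h20, hs, hE.h7, hE.h8, hE.h11, e0, e1, e2, e3]
  refine orLoop_spec (p := b) (A := 2 ^ a.val) ?_ ?_ ?_ ?_ ?_ haτ (by omega) ?_
  · simp [hr₁, hE.h3]
  · simp [hr₁, hE.h7]
  · simp [hr₁, hE.h8]
  · simp
  · simp
  intro t₂ s₂ ht₂ hr₂ hadd hm₂
  simp only [hm₁] at hadd hm₂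
  have hr : ∀ j < 12, s₂.reg j = s.reg j := by
    intro j hj
    rw [hr₂ j (by omega)]
    simp (disch := omega) only [Function.update_of_ne, hr₁]
  have h12 : s₂.reg 12 = b := by rw [hr₂ 12 (by omega)]; simp
  have h13 : s₂.reg 13 = 2 ^ a.val := by rw [hr₂ 13 (by omega)]; simp
  have h14 : s₂.reg 14 = 0 := by rw [hr₂ 14 (by omega)]; simp
  refine Wp.seq (completeArch_spec (τ := τ) (k := k) (B := 0) (p := b) ?_ ?_ ?_ ?_ h12 h14
    (by omega) hP.cap_lt (by omega) ?_)
  · rw [hr 5 (by norm_num), hE.h5]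
  · rw [hr 6 (by norm_num), hE.h6]
  · rw [hr 7 (by norm_num), hE.h7]
  · rw [hr 8 (by norm_num), hE.h8]
  intro t₃ s₃ ht₃ hr₃ hc hm₃
  have hr' : ∀ j < 12, s₃.reg j = s.reg j := fun j hj => (hr₃ j (by omega)).trans (hr j hj)
  have hz : s₃.mem (b + 2 ^ τ) = s.mem (b + 2 ^ τ) := by
    rw [hm₃ _ (by omega), hm₂ _ (by omega)]
  have htr : Transfers τ k (fun S => s.mem (b + S)) ({[a]} : Language (Fin σ))
      (fun S => s₃.mem (b + S)) := Transfers.char hστ hD hadd hc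
  have hmask := hL₀.mul_char hστ a
  refine Wp.seq (Wp.op (Wp.seq (Wp.load (Wp.seq (Wp.ifEq (fun h => Wp.skip (Wp.op ?_)) fun h =>
    Wp.seq (Wp.op (Wp.store (Wp.op ?_))))))))
  all_goals
    simp [BinOp.eval, hr', hE.h3, hE.h8, hE.h11, hz, e4] at h
    intro t₄ ht₄
    simp [BinOp.eval, hr', hr₃, h13, hE.h3, hE.h7, hE.h10, hE.h11, hz, e4, e5, e6]
    refine hQ _ _ (by omega) (hE.congr ?_ ?_ ?_) ?_ ?_ ?_
    · intro j hj
      simp (disch := omega) only [Function.update_of_ne, hr']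
    · simp
    · simp [hr', hE.h11]
    · refine htr.congr (fun S hS => rfl) fun S hS => ?_
      simp (disch := omega) only [Function.update_of_ne]
    · simpa [h, hz] using hmask
    · intro x hx
      simp (disch := omega) only [Function.update_of_ne]
      rw [hm₃ _ (by omega), hm₂ _ (by omega)]

end

/-! ### Induction over the expression -/

section

open scoped Computability

open WordRAM

variable {σ w τ k n i b : ℕ} {Q : ℕ → Store → Prop} {t : ℕ} {s : Store}

/-- The memory `m` holds the string `l` from address `i` on. -/
def SymbolsAt (m : ℕ → ℕ) : ℕ → List (RegexSymbol (Fin σ)) → Prop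
  | _, [] => True
  | i, x :: l => m i = x.code ∧ SymbolsAt m (i + 1) l

lemma symbolsAt_append {m : ℕ → ℕ} (l₁ l₂ : List (RegexSymbol (Fin σ))) (i : ℕ) :
    SymbolsAt m i (l₁ ++ l₂) ↔ SymbolsAt m i l₁ ∧ SymbolsAt m (i + l₁.length) l₂ := by
  induction l₁ generalizing i with
  | nil => simp [SymbolsAt]
  | cons x l₁ ih =>
    simp only [List.cons_append, SymbolsAt, ih, List.length_cons, and_assoc]
    rw [show i + 1 + l₁.length = i + (l₁.length + 1) by omega]

lemma SymbolsAt.congr {m m' : ℕ → ℕ} {l : List (RegexSymbol (Fin σ))} (h : SymbolsAt m i l)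
    (hm : ∀ a < i + l.length, m' a = m a) : SymbolsAt m' i l := by
  induction l generalizing i with
  | nil => trivial
  | cons x l ih =>
    rw [List.length_cons] at hm
    exact ⟨by rw [hm i (by omega)]; exact h.1, ih h.2 fun a ha => hm a (by omega)⟩

lemma symbolsAt_getD (l l' : List (RegexSymbol (Fin σ))) :
    SymbolsAt (fun i => ((l' ++ l).map RegexSymbol.code).getD i 0) l'.length l := by
  induction l generalizing l' with
  | nil => trivial
  | cons x l ih =>
    refine ⟨by simp, ?_⟩
    have := ih (l' ++ [x])
    simpa using this

/-- This makes the look-ahead after `)` unambiguous: a following `*` always belongs to that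
parenthesis. -/
lemma SymbolsAt.head_ne_star {m : ℕ → ℕ} (R : RegularExpression (Fin σ))
    {l : List (RegexSymbol (Fin σ))} (h : SymbolsAt m i (regexString R ++ l)) : m i ≠ 5 := by
  induction R generalizing l with
  | zero => rw [h.1]; simp [RegexSymbol.code]
  | epsilon => rw [h.1]; simp [RegexSymbol.code]
  | char a => rw [h.1]; simp [RegexSymbol.code]; omega
  | plus R₁ R₂ => rw [h.1]; simp [RegexSymbol.code]
  | comp R₁ R₂ ih₁ _ =>
    rw [regexString, List.append_assoc] at h
    exact ih₁ h
  | star R => rw [h.1]; simp [RegexSymbol.code]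

/-- The program is about to process `R`, in the frame at `b`. -/
structure Ready (w τ k n i b : ℕ) (L₀ : Language (Fin σ)) (R : RegularExpression (Fin σ))
    (s : Store) : Prop where
  env : Env τ k n i b s
  base : n < b
  room : b + (regexLength R + 1) * (2 ^ τ + 2) ≤ 2 ^ w
  symbols : SymbolsAt s.mem i (regexString R)
  le : i + regexLength R ≤ n
  next : s.mem (i + regexLength R) ≠ 5
  full : s.mem (b + (2 ^ τ - 1)) = 0
  mask : LetterMask τ L₀ (s.mem (b + 2 ^ τ))

/-- The program has processed `R`, in the frame at `b`. -/
structure Processed (τ k n i b : ℕ) (L₀ : Language (Fin σ)) (R : RegularExpression (Fin σ))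
    (s s' : Store) : Prop where
  env : Env τ k n (i + regexLength R) b s'
  mem : ∀ a, a < b ∨ a = b + 2 ^ τ + 1 → s'.mem a = s.mem a
  transfers : Transfers τ k (fun S => s.mem (b + S)) R.matches' (fun S => s'.mem (b + S))
  mask : LetterMask τ (L₀ * R.matches') (s'.mem (b + 2 ^ τ))

/-- The loop runs over symbols and not over subexpressions. Induction over `R` is possible because
the statement has continuation form: whatever the loop does after `R` is hidden in the second `Wp`.
Each symbol is charged `60 * 2 ^ τ` steps. -/
theorem mainLoop_spec (hP : Params w τ k n) (hστ : σ ≤ τ) (R : RegularExpression (Fin σ))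
    {L₀ : Language (Fin σ)} (h : Ready w τ k n i b L₀ R s)
    (hQ : ∀ t' s', t' ≤ t + 60 * (regexLength R * 2 ^ τ) → Processed τ k n i b L₀ R s s' →
      Wp w mainLoop Q t' s') : Wp w mainLoop Q t s := by
  have h2 := hP.two_le
  induction R generalizing i b s t L₀ with
  | zero =>
    obtain ⟨hE, hb, hroom, hsym, hle, hnext, hfull, hmask⟩ := h
    simp only [regexLength, regexString, List.length_singleton,
      SymbolsAt, RegexSymbol.code, and_true, one_mul] at *
    refine mainLoop_empty hP hE (by omega) hsym (by omega) fun t' s' ht hE' h0 hm => ?_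
    refine hQ t' s' ht ⟨hE', hm, Transfers.zero fun S hS => h0 S (by omega), ?_⟩
    rw [h0 _ (by omega)]
    simpa using LetterMask.zero
  | epsilon =>
    obtain ⟨hE, hb, hroom, hsym, hle, hnext, hfull, hmask⟩ := h
    simp only [regexLength, regexString, List.length_singleton,
      SymbolsAt, RegexSymbol.code, and_true, one_mul] at *
    refine mainLoop_eps hP hE (by omega) hsym fun t' s' ht hE' hm => ?_
    refine hQ t' s' ht ⟨hE', fun a _ => by rw [hm], ?_, ?_⟩
    · rw [hm]
      exact Transfers.one hfull
    · rw [hm]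
      simpa [RegularExpression.matches'] using hmask
  | char a =>
    obtain ⟨hE, hb, hroom, hsym, hle, hnext, hfull, hmask⟩ := h
    simp only [regexLength, regexString, List.length_singleton,
      SymbolsAt, RegexSymbol.code, and_true, one_mul] at *
    exact mainLoop_letter hP hστ hE (by omega) hsym (by omega) hfull hmask
      fun t' s' ht hE' htr hm hmem => hQ t' s' ht ⟨hE', hmem, htr, hm⟩
  | comp R₁ R₂ ih₁ ih₂ =>
    obtain ⟨hE, hb, hroom, hsym, hle, hnext, hfull, hmask⟩ := h
    have hlen : regexLength (R₁.comp R₂) = regexLength R₁ + regexLength R₂ := by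
      simp [regexLength, regexString]
    have hpos := regexLength_pos R₂
    rw [hlen] at hroom hle hnext hQ
    rw [regexString, symbolsAt_append] at hsym
    have hroom₁ : (regexLength R₁ + 1) * (2 ^ τ + 2) ≤
        (regexLength R₁ + regexLength R₂ + 1) * (2 ^ τ + 2) := Nat.mul_le_mul_right _ (by omega)
    have hroom₂ : (regexLength R₂ + 1) * (2 ^ τ + 2) ≤
        (regexLength R₁ + regexLength R₂ + 1) * (2 ^ τ + 2) := Nat.mul_le_mul_right _ (by omega)
    rw [add_mul] at hQ
    refine ih₁ ⟨hE, hb, by omega, hsym.1, by omega,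
      SymbolsAt.head_ne_star R₂ (l := []) (by rw [List.append_nil]; exact hsym.2), hfull,
      hmask⟩ ?_
    intro t₁ s₁ ht₁ ⟨hE₁, hm₁, htr₁, hmask₁⟩
    have hsym₂ : SymbolsAt s.mem (i + regexLength R₁) (regexString R₂) := hsym.2
    refine ih₂ ⟨hE₁, hb, by omega,
      hsym₂.congr fun a ha => hm₁ a (by rw [← regexLength] at ha; omega), by omega, ?_, htr₁.full,
      hmask₁⟩ ?_
    · rw [hm₁ _ (by omega), Nat.add_assoc]
      exact hnext
    intro t₂ s₂ ht₂ ⟨hE₂, hm₂, htr₂, hmask₂⟩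
    refine hQ t₂ s₂ (by omega) ⟨?_, ?_, htr₁.mul hP.pos hστ htr₂, ?_⟩
    · rw [hlen, ← Nat.add_assoc]
      exact hE₂
    · exact fun a ha => (hm₂ a ha).trans (hm₁ a ha)
    · rw [RegularExpression.matches', ← mul_assoc]
      exact hmask₂
  | plus R₁ R₂ ih₁ ih₂ =>
    obtain ⟨hE, hb, hroom, hsym, hle, hnext, hfull, hmask⟩ := h
    have hlen : regexLength (R₁.plus R₂) = regexLength R₁ + regexLength R₂ + 3 := by
      simp [regexLength, regexString]
      omega
    rw [hlen] at hroom hle hnext hQ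
    -- The parts are processed one frame higher, which their smaller length pays for.
    have hroom₁ : (regexLength R₁ + 1) * (2 ^ τ + 2) + (2 ^ τ + 2) ≤
        (regexLength R₁ + regexLength R₂ + 3 + 1) * (2 ^ τ + 2) := by
      rw [← Nat.succ_mul]
      exact Nat.mul_le_mul_right _ (by omega)
    have hroom₂ : (regexLength R₂ + 1) * (2 ^ τ + 2) + (2 ^ τ + 2) ≤
        (regexLength R₁ + regexLength R₂ + 3 + 1) * (2 ^ τ + 2) := by
      rw [← Nat.succ_mul]
      exact Nat.mul_le_mul_right _ (by omega)
    have hroom₃ : 2 ^ τ + 2 ≤ (regexLength R₁ + 1) * (2 ^ τ + 2) :=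
      Nat.le_mul_of_pos_left _ (by omega)
    rw [add_mul, add_mul] at hQ
    simp only [regexString, List.append_assoc, symbolsAt_append, List.length_singleton,
      SymbolsAt, RegexSymbol.code, and_true, ← regexLength.eq_1] at hsym
    obtain ⟨hl, hsym₁, hbar, hsym₂, hr⟩ := hsym
    refine mainLoop_lpar hP hE (by omega) hl (by omega) ?_
    intro t₁ s₁ ht₁ hE₁ hc₁ hz₁ hz₁' hm₁
    refine ih₁ (L₀ := 1) ⟨hE₁, by omega, by omega,
      hsym₁.congr fun a ha => hm₁ a (by rw [← regexLength] at ha; omega), by omega, ?_, ?_, ?_⟩ ?_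
    · rw [hm₁ _ (by omega), hbar]
      norm_num
    · rw [hc₁ _ (by omega), hfull]
    · rw [hz₁]
      exact LetterMask.one
    intro t₂ s₂ ht₂ ⟨hE₂, hm₂, htr₂, hmask₂⟩
    have hm₂' : ∀ a < b + (2 ^ τ + 2), s₂.mem a = s.mem a :=
      fun a ha => (hm₂ a (by omega)).trans (hm₁ a ha)
    refine mainLoop_bar (p := b) hP hE₂ (by omega) ?_ rfl (by omega) ?_
    · rw [hm₂' _ (by omega), hbar]
    intro t₃ s₃ ht₃ hE₃ hp₃ hb₃ hz₃ hz₃' hm₃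
    have hm₃' : ∀ a, a < b ∨ a = b + 2 ^ τ ∨ a = b + 2 ^ τ + 1 → s₃.mem a = s.mem a :=
      fun a ha => (hm₃ a (by omega)).trans (hm₂' a (by omega))
    refine ih₂ (L₀ := 1) ⟨hE₃, by omega, by omega,
      hsym₂.congr fun a ha => hm₃' a (by rw [← regexLength] at ha; omega), by omega, ?_, ?_, ?_⟩ ?_
    · rw [hm₃' _ (by omega), hr]
      norm_num
    · rw [hb₃ _ (by omega), hm₂' _ (by omega), hfull]
    · rw [hz₃]
      exact LetterMask.one
    intro t₄ s₄ ht₄ ⟨hE₄, hm₄, htr₄, hmask₄⟩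
    rw [one_mul] at hmask₂ hmask₄
    refine mainLoop_rpar (p := b) (L := R₁.matches') (M := R₂.matches') (L₀ := L₀) hP hE₄
      (by omega) ?_ ?_ rfl (by omega) ?_ hmask₄ ?_ ?_
    · rw [hm₄ _ (by omega), hm₃' _ (by omega), hr]
    · rw [hm₄ _ (by omega), hm₃' _ (by omega)]
      convert hnext using 2
      ring_nf
    · rw [hm₄ _ (by omega), hz₃']
      exact hmask₂
    · rw [hm₄ _ (by omega), hm₃' _ (by omega)]
      exact hmask
    intro t₅ s₅ ht₅ hE₅ hmax hmask₅ hm₅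
    refine hQ t₅ s₅ (by omega) ⟨?_, ?_, ?_, hmask₅⟩
    · rw [hlen]
      convert hE₅ using 1
      omega
    · intro a ha
      rw [hm₅ a (by omega), hm₄ a (by omega), hm₃' a (by omega)]
    -- Both alternatives started from the table at the opening parenthesis: the first from its copy,
    -- the second from the original that `|` exchanged into the upper frame.
    · refine Transfers.add (htr₂.congr (fun S hS => (hc₁ S hS).symm) (fun S hS => ?_))
        (htr₄.congr (fun S hS => ?_) fun S hS => rfl) (fun S hS => hmax S hS)
      · rw [hm₄ _ (by omega), hp₃ S hS]
      · rw [hb₃ S hS, hm₂' _ (by omega)]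
  | star R ih =>
    obtain ⟨hE, hb, hroom, hsym, hle, hnext, hfull, hmask⟩ := h
    have hlen : regexLength R.star = regexLength R + 3 := by
      simp [regexLength, regexString]
    rw [hlen] at hroom hle hnext hQ
    have hroom₁ : (regexLength R + 1) * (2 ^ τ + 2) + (2 ^ τ + 2) ≤
        (regexLength R + 3 + 1) * (2 ^ τ + 2) := by
      rw [← Nat.succ_mul]
      exact Nat.mul_le_mul_right _ (by omega)
    have hroom₃ : 2 ^ τ + 2 ≤ (regexLength R + 1) * (2 ^ τ + 2) :=
      Nat.le_mul_of_pos_left _ (by omega)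
    rw [add_mul] at hQ
    simp only [regexString, List.append_assoc, symbolsAt_append, List.length_singleton,
      SymbolsAt, RegexSymbol.code, and_true, ← regexLength.eq_1] at hsym
    obtain ⟨hl, hsym₁, hr, hst⟩ := hsym
    refine mainLoop_lpar hP hE (by omega) hl (by omega) ?_
    intro t₁ s₁ ht₁ hE₁ hc₁ hz₁ hz₁' hm₁
    refine ih (L₀ := 1) ⟨hE₁, by omega, by omega,
      hsym₁.congr fun a ha => hm₁ a (by rw [← regexLength] at ha; omega), by omega, ?_, ?_, ?_⟩ ?_
    · rw [hm₁ _ (by omega), hr]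
      norm_num
    · rw [hc₁ _ (by omega), hfull]
    · rw [hz₁]
      exact LetterMask.one
    intro t₂ s₂ ht₂ ⟨hE₂, hm₂, htr₂, hmask₂⟩
    have hm₂' : ∀ a < b + (2 ^ τ + 2), s₂.mem a = s.mem a :=
      fun a ha => (hm₂ a (by omega)).trans (hm₁ a ha)
    rw [one_mul] at hmask₂
    refine mainLoop_star (p := b) (L := R.matches') (L₀ := L₀) hP hστ hE₂ (by omega) ?_ ?_ rfl
      (by omega) hmask₂ ?_ ?_ ?_ ?_
    · rw [hm₂' _ (by omega), hr]
    · rw [hm₂' _ (by omega), hst]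
    · rw [hm₂ _ (by omega), hz₁']
    · rw [hm₂' _ (by omega), hfull]
    · rw [hm₂' _ (by omega)]
      exact hmask
    intro t₃ s₃ ht₃ hE₃ htr₃ hmask₃ hm₃
    refine hQ t₃ s₃ (by omega) ⟨?_, ?_, ?_, hmask₃⟩
    · rw [hlen]
      convert hE₃ using 1
      omega
    · intro a ha
      rw [hm₃ a (by omega), hm₂' a (by omega)]
    · exact htr₃.congr (fun S hS => (hm₂' _ (by omega)).symm) fun S hS => rfl

end

/-! ### Initialisation, read-out and the final bound -/

section

open scoped Computability

open WordRAM

variable {σ w τ k n i b : ℕ} {Q : ℕ → Store → Prop} {t : ℕ} {s : Store}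

/-- Set up the constants and the frame for the whole expression. -/
def setupCmd : Cmd :=
  .op .add 20 2 2 ;; .ifLt 20 1 (.op .add 1 20 8) .skip ;;
    .op .shl 3 7 0 ;; .op .sub 6 3 7 ;; .op .add 9 3 7 ;; .op .add 4 9 7 ;;
    .op .add 5 1 7 ;; .op .add 11 2 7 ;; .store 11 7 ;; .op .add 20 11 3 ;; .store 20 3 ;;
    .const 10 0

/-- Replace the empty alphabet by one with a single letter, then set up. -/
def initCmd : Cmd :=
  .const 7 1 ;; .const 8 0 ;; .ifEq 0 8 (.const 0 1 ;; .const 1 0) .skip ;; setupCmd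

/-- Test whether the table at register `11` has an entry of at least register `5`. -/
def scanCmd : Cmd :=
  .store 8 8 ;;
    .forLt 3 (.op .add 21 11 20 ;; .load 22 21 ;; .ifLt 22 5 .skip (.store 8 7)) ;;
    .load 0 8

/-- The program for `k`-ESU. -/
def esuCmd : Cmd := initCmd ;; mainLoop ;; scanCmd

/-- Memory cell `0`, whose symbol has been read by then, serves as the flag, because the loop
invariant of `Wp.forLt` concerns the memory; `0 < b` keeps it outside the table. -/
lemma scanCmd_spec (hE : Env τ k n i b s) (hb : 0 < b) (hbN : b + 2 ^ τ < 2 ^ w)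
    (hQ : ∀ t' s', t' ≤ t + 2 ^ τ * 8 + 5 →
      ((∃ S < 2 ^ τ, k + 1 ≤ s.mem (b + S)) ∧ s'.reg 0 = 1 ∨
        (¬ ∃ S < 2 ^ τ, k + 1 ≤ s.mem (b + S)) ∧ s'.reg 0 = 0) → Q t' s') :
    Wp w scanCmd Q t s := by
  refine Wp.seq (Wp.store (Wp.seq ?_))
  simp only [hE.h8]
  refine Wp.forLt (fun j m => (∀ a, a ≠ 0 → m a = s.mem a) ∧
    ((∃ S < j, k + 1 ≤ s.mem (b + S)) ∧ m 0 = 1 ∨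
      (¬ ∃ S < j, k + 1 ≤ s.mem (b + S)) ∧ m 0 = 0))
    (2 ^ τ) 5 (by norm_num) hE.h3 hE.h7 (by omega) ⟨?_, Or.inr ⟨?_, ?_⟩⟩ ?_ ?_
  · intro a ha
    simp [ha]
  · rintro ⟨S, hS, -⟩
    omega
  · simp
  · rintro j hj s' t' hr h20 ⟨hJ, hJ'⟩
    simp only at hr
    have e1 : (b + j) % 2 ^ w = b + j := Nat.mod_eq_of_lt (by omega)
    have hbj := hJ (b + j) (by omega)
    refine Wp.seq (Wp.op (Wp.seq (Wp.load (Wp.ifLt (fun h => Wp.skip ?_) fun h =>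
      Wp.store ?_))))
    all_goals
      simp [BinOp.eval, hr, hE.h11, hE.h5, h20, e1, hbj] at h
      simp [BinOp.eval, hr, hE.h7, hE.h8, hE.h11, h20, e1]
      refine ⟨?_, ?_, ?_⟩
      · intro i hi
        simp (disch := omega) only [Function.update_of_ne, hr]
    · exact hJ
    · rcases hJ' with ⟨⟨S, hS, hk⟩, h1⟩ | ⟨hno, h1⟩
      · exact Or.inl ⟨⟨S, by omega, hk⟩, h1⟩
      · refine Or.inr ⟨fun S hS => ?_, h1⟩
        by_cases hSj : S = j
        · subst hSj
          omega
        · by_contra hcon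
          exact hno ⟨S, by omega, by omega⟩
    · intro a ha
      simpa [ha] using hJ a ha
    · exact ⟨j, le_rfl, h⟩
  · rintro t' s' ht hr ⟨-, hJ⟩
    simp only at hr
    refine Wp.load ?_
    refine hQ _ _ (by omega) ?_
    simpa [hr, hE.h8] using hJ

lemma setupCmd_spec {k₀ : ℕ} (hP : Params w τ (min k₀ (2 * n)) n) (hnw : 2 * n < 2 ^ w)
    (h0 : s.reg 0 = τ) (h1 : s.reg 1 = k₀) (h2 : s.reg 2 = n) (h7 : s.reg 7 = 1)
    (h8 : s.reg 8 = 0)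
    (hQ : ∀ t' s', t' ≤ t + 20 → Env τ (min k₀ (2 * n)) n 0 (n + 1) s' →
      s'.mem = Function.update (Function.update s.mem (n + 1) 1) (n + 1 + 2 ^ τ) (2 ^ τ) →
      Q t' s') :
    Wp w setupCmd Q t s := by
  have hbd := hP.bound
  have hτ := hP.two_le
  have hk := hP.cap_lt
  have e1 : (n + n) % 2 ^ w = 2 * n := by rw [← two_mul]; exact Nat.mod_eq_of_lt hnw
  have e1' : 2 * n % 2 ^ w = 2 * n := Nat.mod_eq_of_lt hnw
  have e2 : (1 <<< τ) % 2 ^ w = 2 ^ τ := by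
    rw [Nat.shiftLeft_eq, one_mul]
    exact Nat.mod_eq_of_lt (by omega)
  have e3 : (2 ^ τ + 2 ^ w - 1) % 2 ^ w = 2 ^ τ - 1 := by
    rw [show 2 ^ τ + 2 ^ w - 1 = 2 ^ τ - 1 + 2 ^ w by omega, Nat.add_mod_right]
    exact Nat.mod_eq_of_lt (by omega)
  have e4 : (2 ^ τ + 1) % 2 ^ w = 2 ^ τ + 1 := Nat.mod_eq_of_lt (by omega)
  have e5 : (2 ^ τ + 1 + 1) % 2 ^ w = 2 ^ τ + 2 := Nat.mod_eq_of_lt (by omega)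
  have e6 : (n + 1) % 2 ^ w = n + 1 := Nat.mod_eq_of_lt (by omega)
  have e7 : (n + 1 + 2 ^ τ) % 2 ^ w = n + 1 + 2 ^ τ := Nat.mod_eq_of_lt (by omega)
  have e8 : (min k₀ (2 * n) + 1) % 2 ^ w = min k₀ (2 * n) + 1 := Nat.mod_eq_of_lt hk
  generalize hk' : min k₀ (2 * n) = k' at *
  have key : ∀ t₁ s₁, t₁ ≤ t + 4 → s₁.reg 0 = τ → s₁.reg 1 = k' → s₁.reg 2 = n →
      s₁.reg 7 = 1 → s₁.reg 8 = 0 → s₁.mem = s.mem → Wp w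
        (.op .shl 3 7 0 ;; .op .sub 6 3 7 ;; .op .add 9 3 7 ;; .op .add 4 9 7 ;;
          .op .add 5 1 7 ;; .op .add 11 2 7 ;; .store 11 7 ;; .op .add 20 11 3 ;; .store 20 3 ;;
          .const 10 0) Q t₁ s₁ := by
    intro t₁ s₁ ht₁ h0 h1 h2 h7 h8 hm
    refine Wp.seq (Wp.op (Wp.seq (Wp.op (Wp.seq (Wp.op (Wp.seq (Wp.op ?_)))))))
    simp only [BinOp.eval, h0, h7, e2, Function.update_self]
    simp [h7, e3, e4, e5]
    refine Wp.seq (Wp.op (Wp.seq (Wp.op (Wp.seq (Wp.store (Wp.seq (Wp.op (Wp.seq (Wp.store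
      (Wp.const ?_))))))))))
    simp [BinOp.eval, h1, h2, h7, hm, e6, e7, e8]
    refine hQ _ _ (by omega) ?_ rfl
    constructor <;> simp [h1, h2, h7, h8]
  refine Wp.seq (Wp.op (Wp.seq (Wp.ifLt (fun h => Wp.op ?_) fun h => Wp.skip ?_)))
  · simp [BinOp.eval, h1, h2, e1] at h
    refine key _ _ (by omega) ?_ ?_ ?_ ?_ ?_ rfl <;>
      simp [BinOp.eval, h0, h2, h7, h8, e1, e1']
    omega
  · simp [BinOp.eval, h1, h2, e1] at h
    refine key _ _ (by omega) ?_ ?_ ?_ ?_ ?_ rfl <;> simp [h0, h1, h2, h7, h8]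
    omega

lemma initCmd_spec {m : ℕ → ℕ} (hP : Params w (max σ 1) (min (if σ = 0 then 0 else k) (2 * n)) n)
    (hnw : 2 * n < 2 ^ w)
    (hQ : ∀ t' s', t' ≤ t + 30 →
      Env (max σ 1) (min (if σ = 0 then 0 else k) (2 * n)) n 0 (n + 1) s' →
      s'.mem = Function.update (Function.update m (n + 1) 1) (n + 1 + 2 ^ max σ 1)
        (2 ^ max σ 1) → Q t' s') :
    Wp w initCmd Q t ⟨fun i => [σ, k, n].getD i 0, m⟩ := by
  have hbd := hP.bound
  have e0 : 1 % 2 ^ w = 1 := Nat.mod_eq_of_lt (by omega)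
  refine Wp.seq (Wp.const (Wp.seq (Wp.const (Wp.seq (Wp.ifEq
    (fun h => Wp.seq (Wp.const (Wp.const ?_))) fun h => Wp.skip ?_)))))
  all_goals
    simp [e0] at h
    refine setupCmd_spec hP hnw ?_ ?_ ?_ ?_ ?_ fun t' s' ht hE hm => hQ t' s' (by omega) hE hm
    all_goals simp [e0, h]
  omega

/-- The initial table holds only the state `(0, 0)`. Taking `max σ 1` letters makes the empty set
differ from the full one, so this state is admissible even for the empty alphabet. -/
lemma existsKUniversal_iff_table (R : RegularExpression (Fin σ)) {D D' : ℕ → ℕ}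
    (hD0 : D 0 = 1) (hD : ∀ S < 2 ^ max σ 1, S ≠ 0 → D S = 0)
    (h : Transfers (max σ 1) (min (if σ = 0 then 0 else k) (2 * regexLength R)) D R.matches' D') :
    ExistsKUniversal k R.matches' ↔
      ∃ S < 2 ^ max σ 1, min (if σ = 0 then 0 else k) (2 * regexLength R) + 1 ≤ D' S := by
  have hpos : 0 < max σ 1 := by omega
  have h1 : 1 < 2 ^ max σ 1 := Nat.one_lt_two_pow (by omega)
  set k' := min (if σ = 0 then 0 else k) (2 * regexLength R) with hk'
  have hx : HasState (max σ 1) D (0, 0) := ⟨by dsimp only; omega, hD0⟩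
  have hdom : ∀ x y : ℕ × ℕ, Dominated k' x y → k' ≤ x.1 → k' ≤ y.1 := by
    rintro x y (h | h | h) hx <;> omega
  have hiff : ExistsKUniversal k R.matches' ↔
      ∃ v ∈ R.matches', k' ≤ (archRun (max σ 1) k' (0, 0) v).1 := by
    by_cases hσ : σ = 0
    -- Over the empty alphabet every word is `k`-universal, so only nonemptiness is asked; this is
    -- the question for the cap `0`.
    · subst hσ
      have : k' = 0 := by simp [hk']
      rw [this]
      simp only [Nat.zero_le, and_true]
      constructor
      · rintro ⟨v, hv, -⟩
        exact ⟨v, hv⟩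
      · rintro ⟨v, hv⟩
        refine ⟨v, hv, fun u _ => ?_⟩
        cases u with
        | nil => simp
        | cons a _ => exact a.elim0
    · rw [← existsKUniversal_min_iff (by omega)]
      rw [if_neg hσ] at hk'
      rw [← hk', show max σ 1 = σ by omega]
      exact exists_congr fun v => and_congr_right fun _ =>
        isKUniversal_iff_le_archRun (by omega) v
  rw [hiff]
  constructor
  · rintro ⟨v, hv, hk⟩
    obtain ⟨y, hy, hd⟩ := h.complete _ hx v hv
    have := hdom _ _ hd hk
    exact ⟨y.2, by have := hy.1; omega, by rw [hy.2]; omega⟩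
  · rintro ⟨S, hS, hk⟩
    have hne : S ≠ 2 ^ max σ 1 - 1 := by
      rintro rfl
      rw [h.full] at hk
      omega
    obtain ⟨⟨c, T⟩, hT, v, hv, hd⟩ := h.sound (D' S - 1, S)
      ⟨by dsimp only; omega, by dsimp only; omega⟩
    have hT0 : T = 0 := by
      by_contra hne
      have h3 := hT.1
      have h4 := hT.2
      dsimp only at h3 h4
      rw [hD T (by omega) hne] at h4
      omega
    subst hT0
    have hc : c = 0 := by
      have h4 := hT.2
      dsimp only at h4
      omega
    subst hc
    exact ⟨v, hv, hdom _ _ hd (by dsimp only; omega)⟩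

/-- The compiled program is correct whenever the structured program is. -/
lemma decidesWithin_of_wp {c : Cmd} {s : State} {T : ℕ} {A : Prop} (hpc : s.pc = 0)
    (h : Wp w c (fun t' s' => t' ≤ T ∧ (A ∧ s'.reg 0 = 1 ∨ ¬ A ∧ s'.reg 0 = 0)) 0
      ⟨s.reg, s.mem⟩) : DecidesWithin w (c.compile 0) s T A := by
  obtain ⟨m, s', he, hm, hA⟩ := h
  have hs := he.compile (P := c.compile 0) 0 ⟨[], by simp⟩
  obtain ⟨pc, reg, mem⟩ := s
  dsimp only at hpc hs
  subst hpc
  refine ⟨m, by omega, ?_, ?_⟩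
  · left
    rw [hs]
    simp [Cmd.length_compile]
  · rw [hs]
    exact hA

end

end KUniversality

open KUniversality WordRAM in
theorem mainTheorem3 :
    ∃ (P : List WordRAM.Instr) (c : ℕ),
      ∀ (σ : ℕ) (R : RegularExpression (Fin σ)) (k w : ℕ),
        c * (regexLength R * 2 ^ σ) ≤ 2 ^ w → k < 2 ^ w →
          WordRAM.DecidesWithin w P (esuInput R k) (c * (regexLength R * 2 ^ σ))
            (ExistsKUniversal k R.matches') := by
  -- Let `X = n * 2 ^ σ`, so `X ≥ 1`. Since `2 ^ τ ≤ 2 * 2 ^ σ`, the phases take at most `30`, `120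
  -- * X`, `2` and `16 * X + 5` steps. The memory needs at most `20 * X` cells, so the same constant
  -- serves for both bounds.
  refine ⟨esuCmd.compile 0, 200, fun σ R k w hw _ => decidesWithin_of_wp rfl ?_⟩
  set n := regexLength R with hn
  set τ := max σ 1 with hτ
  set k' := min (if σ = 0 then 0 else k) (2 * n) with hk'
  have hnpos : 0 < n := regexLength_pos R
  have hσpos : 0 < 2 ^ σ := by positivity
  have hX₁ : n ≤ n * 2 ^ σ := Nat.le_mul_of_pos_right _ hσpos
  have hX₂ : 2 ^ σ ≤ n * 2 ^ σ := Nat.le_mul_of_pos_left _ hnpos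
  have hτσ : 2 ^ τ ≤ 2 * 2 ^ σ := by
    rw [← pow_succ']
    exact Nat.pow_le_pow_right (by norm_num) (by omega)
  have hnτ : n * 2 ^ τ ≤ 2 * (n * 2 ^ σ) :=
    (Nat.mul_le_mul_left n hτσ).trans_eq (by ring)
  have hsize : (n + 1) + (n + 2) * (2 ^ τ + 2) ≤ 20 * (n * 2 ^ σ) := by
    have : (n + 2) * (2 ^ τ + 2) = n * 2 ^ τ + 2 * n + 2 * 2 ^ τ + 4 := by ring
    omega
  have hk2 : k' ≤ 2 * n := min_le_right _ _
  have hP : Params w τ k' n := ⟨by omega, by omega, by omega⟩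
  have h2 := hP.two_le
  refine Wp.seq (initCmd_spec hP (by omega) ?_)
  intro t₁ s₁ ht₁ hE₁ hm₁
  set m := (esuInput R k).mem with hm
  have hinput : ∀ a, n ≤ a → m a = 0 := by
    intro a ha
    rw [hm, esuInput]
    exact List.getD_eq_default _ _ (by rw [List.length_map]; exact ha)
  have hroom : (n + 1) * (2 ^ τ + 2) ≤ (n + 2) * (2 ^ τ + 2) :=
    Nat.mul_le_mul_right _ (by omega)
  have hmem : ∀ a, a ≠ n + 1 → a ≠ n + 1 + 2 ^ τ → s₁.mem a = m a := by
    intro a ha ha'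
    rw [hm₁, Function.update_of_ne ha', Function.update_of_ne ha]
  have hsize' := hP.size_le
  refine Wp.seq (mainLoop_spec (L₀ := 1) hP (le_max_left σ 1) R
    ⟨hE₁, by omega, by rw [← hn]; omega, ?_, by omega, ?_, ?_, ?_⟩ ?_)
  · refine SymbolsAt.congr (m := m) (symbolsAt_getD (regexString R) []) fun a ha => ?_
    rw [← regexLength] at ha
    exact hmem a (by omega) (by omega)
  · rw [hmem _ (by omega) (by omega), hinput _ (by omega)]
    norm_num
  · rw [hmem _ (by omega) (by omega), hinput _ (by omega)]
  · rw [hm₁, Function.update_self]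
    exact LetterMask.one
  intro t₂ s₂ ht₂ hR
  have hE₂ := hR.env
  have hlen : regexLength R * 2 ^ τ = n * 2 ^ τ := rfl
  refine Wp.whileLt_done (by rw [hE₂.h10, hE₂.h2]; omega) ?_
  refine scanCmd_spec hE₂ (by omega) (by omega) fun t₃ s₃ ht₃ hres => ⟨by omega, ?_⟩
  rwa [existsKUniversal_iff_table R ?_ ?_ hR.transfers]
  · change s₁.mem (n + 1) = 1
    rw [hm₁, Function.update_of_ne (show n + 1 ≠ n + 1 + 2 ^ τ by omega), Function.update_self]
  · intro S hS hS0
    change S < 2 ^ τ at hS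
    change s₁.mem (n + 1 + S) = 0
    rw [hmem _ (by omega) (by omega), hinput _ (by omega)]
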